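/- **Model.** For every sample size $n$ consider the Gaussian linear mixed model $$Y=\mu+Z\nu+W\gamma+\epsilon,\qquad Z\in\mathbb R^{n\times v},\ W\in\mathbb R^{n\times r},$$ with fixed-effect covariates $X\in\mathbb R^{n\times p}$; all objects, including $p,v,r$, may depend on $n$, the variances do not. Here $\nu\sim\mathcal N_v(0,\sigma_\nu^2I_v)$ and $\epsilon\sim\mathcal N_n(0,\sigma_\epsilon^2I_n)$ are independent, $\sigma_\nu^2\ge 0$, $\sigma_\epsilon^2>0$, and $\gamma$ is arbitrary. Let $A\in\mathbb R^{n_a\times n}$, $B\in\mathbb R^{n_b\times n}$ have orthonormal rows with $AB^{\mathsf T}=0$, $AW=0$, $BZ=0$, $BW=0$; put $Q=\binom{A}{B}$ and let $AZZ^{\mathsf T}A^{\mathsf T}=VDV^{\mathsf T}$ with $V$ orthogonal and $D=\mathrm{diag}(d_1,\dots,d_{n_a})$, all $d_k>0$. The quantities $(X,Z,W,\mu,A,B,V,D,\alpha)$, with $\alpha$ the tuning parameter below, are either fixed or random and jointly independent of $(\nu,\epsilon)$; in the latter case the conditions on them below hold almost surely. **Estimators.** Let $\mathcal M_u$ be the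 collection of all sets of $u$ columns of $X$. For $m\in\mathcal M_u$ let $\hat\beta_{m,Q}$ be the least-squares estimator in the regression of $QY$ on $QX_m$ (extended by zero to $\mathbb R^p$), and for $\alpha>0$ let $$\hat\beta=\sum_{m\in\mathcal M_u}w_m\hat\beta_{m,Q},\qquad w_m=\frac{\exp(-\frac1\alpha\|QY-QX\hat\beta_{m,Q}\|^2)}{\sum_{k\in\mathcal M_u}\exp(-\frac1\alpha\|QY-QX\hat\beta_{k,Q}\|^2)},$$ $$\hat\sigma_\epsilon^2=\frac1{n_b}\|BY-BX\hat\beta\|^2,\qquad \hat\sigma_\nu^2=\frac{1}{\mathrm{Tr}(D^{-1})}\|D^{-1/2}V^{\mathsf T}(AY-AX\hat\beta)\|^2-\hat\sigma_\epsilon^2 .$$ **Assumptions.** 1. $\mu$ is weakly sparse relative to $X$ with sparsity $s$ at rate $\sqrt n$: there are sets $S$ of $s$ columns of $X$ such that the squared norm of the projection of $\mu$ onto the orthogonal complement of the span of these columns is $o(\sqrt n)$. 2. $\lambda_{\max}(\sigma_\nu^2QZZ^{\mathsf T}Q^{\mathsf T}+\sigma_\epsilon^2I)=\mathcal O(1)$,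 and $\alpha>0$ is bounded in $n$ (for instance any bounded $\alpha\ge 6\lambda_{\max}(\sigma_\nu^2QZZ^{\mathsf T}Q^{\mathsf T}+\sigma_\epsilon^2I)$). 3. $u\le p$, $\liminf_n(u-s)\ge 0$, $u\log(p)/\sqrt n\to 0$ and $n_a\asymp n_b\asymp n$. 4. With $\omega_k=\sigma_\nu^2+\sigma_\epsilon^2d_k^{-1}$, $\|\omega\|_\infty/\|\omega\|_2\to 0$. 5. For some constants $\sigma_a^2,\sigma_b^2,\bar d>0$, $$\frac{2n\|\omega\|_2^2}{(\mathrm{Tr}(D^{-1}))^2}\to\sigma_a^2,\qquad \frac{2\sigma_\epsilon^4n}{n_b}\to\sigma_b^2,\qquad \frac{n_a}{\mathrm{Tr}(D^{-1})}\to\bar d .$$ **Conclusion.** As $n\to\infty$, with $\hat d\triangleq n_a/\mathrm{Tr}(D^{-1})$, $$\hat\sigma_a^2\triangleq\frac{2n\sum_{k=1}^{n_a}(\hat\sigma_\nu^2/\hat d+d_k^{-1}\hat\sigma_\epsilon^2)^2}{(\mathrm{Tr}(D^{-1}))^2}\overset{\mathbb P}{\to}\sigma_a^2,\qquad \hat\sigma_b^2\triangleq\frac{2n(\hat\sigma_\epsilon^2)^2}{n_b}\overset{\mathbb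 P}{\to}\sigma_b^2,\qquad \hat d\overset{\mathbb P}{\to}\bar d .$$ -/

import Mathlib

open MeasureTheory ProbabilityTheory Filter Topology Asymptotics

namespace MixedModel

noncomputable section

/-! ### Least squares, exponential weighting and weak sparsity -/

/-- The collection `𝓜_u` of all models with `u` fixed-effect covariates out of `p`. -/
def models (p u : ℕ) : Finset (Finset (Fin p)) :=
  Finset.powersetCard u Finset.univ

/-- The vector `b` only uses the covariates of the model `m`. -/
def SupportedOn {p : ℕ} (m : Finset (Fin p)) (b : EuclideanSpace ℝ (Fin p)) : Prop :=
  ∀ j, j ∉ m → b j = 0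

/-- `b` is a least-squares coefficient vector for the response `y` and the design `M`
in the model `m`, i.e. with the design formed by the columns of `M` indexed by `m`. -/
def IsLeastSquares {ι : Type*} [Fintype ι] {p : ℕ} (M : Matrix ι (Fin p) ℝ)
    (y : EuclideanSpace ℝ ι) (m : Finset (Fin p)) (b : EuclideanSpace ℝ (Fin p)) : Prop :=
  SupportedOn m b ∧ ∀ b', SupportedOn m b' → ‖y - M.toEuclideanLin b‖ ≤ ‖y - M.toEuclideanLin b'‖

theorem exists_isLeastSquares {ι : Type*} [Fintype ι] {p : ℕ} (M : Matrix ι (Fin p) ℝ)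
    (y : EuclideanSpace ℝ ι) (m : Finset (Fin p)) : ∃ b, IsLeastSquares M y m b := by
  let U : Submodule ℝ (EuclideanSpace ℝ (Fin p)) :=
    { carrier := {b | SupportedOn m b}
      add_mem' := fun {a b} ha hb j hj => by
        simp [ha j hj, hb j hj]
      zero_mem' := fun j _ => by simp
      smul_mem' := fun c b hb j hj => by simp [hb j hj] }
  let K : Submodule ℝ (EuclideanSpace ℝ ι) := U.map M.toEuclideanLin
  obtain ⟨b, hb, hbK⟩ : K.starProjection y ∈ K := K.starProjection_apply_mem y
  refine ⟨b, hb, fun b' hb' => ?_⟩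
  rw [hbK, K.starProjection_minimal]
  exact ciInf_le ⟨0, by rintro _ ⟨x, rfl⟩; positivity⟩
    (⟨M.toEuclideanLin b', b', hb', rfl⟩ : K)

/-- The least-squares estimator in the model `m`. If the columns of `M` indexed by `m` are
linearly dependent, one of the minimisers is selected; the fitted vector does not depend
on this selection. -/
def leastSquares {ι : Type*} [Fintype ι] {p : ℕ} (M : Matrix ι (Fin p) ℝ)
    (y : EuclideanSpace ℝ ι) (m : Finset (Fin p)) : EuclideanSpace ℝ (Fin p) :=
  (exists_isLeastSquares M y m).choose

/-- The unnormalised exponential weight of the model `m`. -/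
def rawWeight {ι : Type*} [Fintype ι] {p : ℕ} (M : Matrix ι (Fin p) ℝ)
    (y : EuclideanSpace ℝ ι) (α : ℝ) (m : Finset (Fin p)) : ℝ :=
  Real.exp (-(1 / α) * ‖y - M.toEuclideanLin (leastSquares M y m)‖ ^ 2)

/-- The exponential weight of the model `m` among all models of size `u`. -/
def expWeight {ι : Type*} [Fintype ι] {p : ℕ} (M : Matrix ι (Fin p) ℝ)
    (y : EuclideanSpace ℝ ι) (α : ℝ) (u : ℕ) (m : Finset (Fin p)) : ℝ :=
  rawWeight M y α m / ∑ k ∈ models p u, rawWeight M y α k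

/-- The exponentially weighted estimator over all models of size `u`. -/
def expWeightEstimator {ι : Type*} [Fintype ι] {p : ℕ} (M : Matrix ι (Fin p) ℝ)
    (y : EuclideanSpace ℝ ι) (α : ℝ) (u : ℕ) : EuclideanSpace ℝ (Fin p) :=
  ∑ m ∈ models p u, expWeight M y α u m • leastSquares M y m

/-- The span of the columns of `M` indexed by `m`. -/
def colSpan {ι : Type*} [Fintype ι] {p : ℕ} (M : Matrix ι (Fin p) ℝ) (m : Finset (Fin p)) :
    Submodule ℝ (EuclideanSpace ℝ ι) :=
  Submodule.span ℝ ((fun j => WithLp.toLp 2 (fun i => M i j)) '' (m : Set (Fin p)))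

/-- The weak sparsity property of `μ` relative to `X` with sparsity `s` at rate `k`: for
suitable models `S n` of size `s n`, the squared norm of the projection of `μ n` onto the
orthogonal complement of the columns of `X n` indexed by `S n` is `o(k n)`. -/
def WeaklySparse {p : ℕ → ℕ} (X : ∀ n, Matrix (Fin n) (Fin (p n)) ℝ)
    (μ : ∀ n, EuclideanSpace ℝ (Fin n)) (s : ℕ → ℕ) (k : ℕ → ℝ) : Prop :=
  ∃ S : ∀ n, Finset (Fin (p n)), (∀ n, S n ∈ models (p n) (s n)) ∧
    (fun n => ‖(colSpan (X n) (S n))ᗮ.starProjection (μ n)‖ ^ 2) =o[atTop] k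

/-- The maximal eigenvalue of a real symmetric matrix. -/
def lambdaMax {ι : Type*} [Fintype ι] [DecidableEq ι] (M : Matrix ι ι ℝ) : ℝ :=
  sSup (spectrum ℝ M)

/-! ### The mixed model and its two reduced models -/

/-- All ingredients of the mixed model with `n` observations, and of its analysis, other than
the random effects and the errors: the fixed-effect covariates `X`, the random-effect designs
`Z` and `W`, the mean vector `μ`, the matrices `A` and `B` of the reduced models, the
eigenvectors `V` and the eigenvalues `d` for `A Z Zᵀ Aᵀ`, and the tuning parameter `α`. -/
structure Design (n p v r na nb : ℕ) where
  X : Matrix (Fin n) (Fin p) ℝ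
  Z : Matrix (Fin n) (Fin v) ℝ
  W : Matrix (Fin n) (Fin r) ℝ
  μ : EuclideanSpace ℝ (Fin n)
  A : Matrix (Fin na) (Fin n) ℝ
  B : Matrix (Fin nb) (Fin n) ℝ
  V : Matrix (Fin na) (Fin na) ℝ
  d : Fin na → ℝ
  α : ℝ

namespace Design

variable {n p v r na nb : ℕ}

/-- A design as a tuple of arrays of real numbers. -/
def toTuple (D : Design n p v r na nb) :
    (Fin n → Fin p → ℝ) × (Fin n → Fin v → ℝ) × (Fin n → Fin r → ℝ) × (Fin n → ℝ) ×
      (Fin na → Fin n → ℝ) × (Fin nb → Fin n → ℝ) × (Fin na → Fin na → ℝ) × (Fin na → ℝ) × ℝ :=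
  (fun i j => D.X i j, fun i j => D.Z i j, fun i j => D.W i j, fun i => D.μ i,
    fun i j => D.A i j, fun i j => D.B i j, fun i j => D.V i j, D.d, D.α)

/-- The Borel structure of a finite-dimensional space of arrays. -/
instance : MeasurableSpace (Design n p v r na nb) :=
  MeasurableSpace.comap toTuple inferInstance

/-- The stacked matrix `Q` with blocks `A` and `B`. -/
def Q (D : Design n p v r na nb) : Matrix (Fin na ⊕ Fin nb) (Fin n) ℝ :=
  Matrix.fromRows D.A D.B

/-- The matrix `D⁻¹`, where `D` is the diagonal matrix of the eigenvalues. -/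
def Dinv (D : Design n p v r na nb) : Matrix (Fin na) (Fin na) ℝ :=
  Matrix.diagonal fun k => (D.d k)⁻¹

/-- The whitening matrix `D^{-1/2} Vᵀ`. -/
def whiten (D : Design n p v r na nb) : Matrix (Fin na) (Fin na) ℝ :=
  Matrix.diagonal (fun k => (Real.sqrt (D.d k))⁻¹) * D.V.transpose

/-- The response `Y = μ + Z ν + W γ + ε`. -/
def response (D : Design n p v r na nb) (ν : EuclideanSpace ℝ (Fin v))
    (γ : EuclideanSpace ℝ (Fin r)) (ε : EuclideanSpace ℝ (Fin n)) : EuclideanSpace ℝ (Fin n) :=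
  D.μ + D.Z.toEuclideanLin ν + D.W.toEuclideanLin γ + ε

/-- `A` and `B` have orthonormal rows that are mutually orthogonal and give the reduced models
`A Y = A μ + A Z ν + A ε` and `B Y = B μ + B ε`; moreover `A Z Zᵀ Aᵀ = V D Vᵀ` with `V`
orthogonal and `D` diagonal and invertible. -/
structure IsReduction (D : Design n p v r na nb) : Prop where
  orthonormal_A : D.A * D.A.transpose = 1
  orthonormal_B : D.B * D.B.transpose = 1
  orthogonal : D.A * D.B.transpose = 0
  A_W : D.A * D.W = 0
  B_Z : D.B * D.Z = 0
  B_W : D.B * D.W = 0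
  V_orthogonal : D.V ∈ Matrix.orthogonalGroup (Fin na) ℝ
  spectral : D.A * D.Z * D.Z.transpose * D.A.transpose
    = D.V * Matrix.diagonal D.d * D.V.transpose
  d_pos : ∀ k, 0 < D.d k

/-- The vector `σ_ν² 1 + σ_ε² d⁻¹` of the variances of the whitened observations. -/
def noiseVar (D : Design n p v r na nb) (σν2 σε2 : ℝ) : Fin na → ℝ :=
  fun k => σν2 + σε2 * (D.d k)⁻¹

/-! ### Estimators; `Y` is the response and `u` the size of the models that are averaged -/

/-- The exponentially weighted estimator of the fixed effects from the data `(Q Y, Q X)`. -/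
def betaHat (D : Design n p v r na nb) (u : ℕ) (Y : EuclideanSpace ℝ (Fin n)) :
    EuclideanSpace ℝ (Fin p) :=
  expWeightEstimator (D.Q * D.X) (D.Q.toEuclideanLin Y) D.α u

/-- The estimator of `σ_ε²`. -/
def sigmaEpsSqHat (D : Design n p v r na nb) (u : ℕ) (Y : EuclideanSpace ℝ (Fin n)) : ℝ :=
  1 / (nb : ℝ) *
    ‖D.B.toEuclideanLin Y - (D.B * D.X).toEuclideanLin (D.betaHat u Y)‖ ^ 2

/-- The estimator `σ̂_ν²`. -/
def sigmaNuSqHat (D : Design n p v r na nb) (u : ℕ) (Y : EuclideanSpace ℝ (Fin n)) : ℝ :=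
  1 / D.Dinv.trace *
    ‖(D.whiten * D.A).toEuclideanLin Y
      - (D.whiten * D.A * D.X).toEuclideanLin (D.betaHat u Y)‖ ^ 2
  - D.sigmaEpsSqHat u Y

/-- The estimator `d̂`. -/
def dHat (D : Design n p v r na nb) : ℝ :=
  (na : ℝ) / D.Dinv.trace

/-- The estimator `σ̂_a²`. -/
def sigmaASqHat (D : Design n p v r na nb) (u : ℕ) (Y : EuclideanSpace ℝ (Fin n)) : ℝ :=
  2 * (n : ℝ) *
    (∑ k, (D.sigmaNuSqHat u Y / D.dHat + (D.d k)⁻¹ * D.sigmaEpsSqHat u Y) ^ 2)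
    / D.Dinv.trace ^ 2

/-- The estimator `σ̂_b²`. -/
def sigmaBSqHat (D : Design n p v r na nb) (u : ℕ) (Y : EuclideanSpace ℝ (Fin n)) : ℝ :=
  2 * (n : ℝ) * (D.sigmaEpsSqHat u Y) ^ 2 / (nb : ℝ)

end Design

/-- The conditions on a (non-random) sequence of designs. -/
structure DesignConditions {p v r na nb : ℕ → ℕ}
    (D : ∀ n, Design n (p n) (v n) (r n) (na n) (nb n)) (s : ℕ → ℕ)
    (σν2 σε2 σa2 dbar : ℝ) : Prop where
  reduction : ∀ n, (D n).IsReduction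
  weaklySparse : WeaklySparse (fun n => (D n).X) (fun n => (D n).μ) s (fun n => Real.sqrt n)
  α_pos : ∀ n, 0 < (D n).α
  α_bounded : (fun n => (D n).α) =O[atTop] fun _ => (1 : ℝ)
  /-- `λ_max(Q Z Ψ Zᵀ Qᵀ + σ_ε² I) = O(1)` with `Ψ = σ_ν² I`. -/
  lambdaMax_bounded :
    (fun n => lambdaMax (σν2 • ((D n).Q * (D n).Z * (D n).Z.transpose * (D n).Q.transpose)
      + σε2 • 1)) =O[atTop] fun _ => (1 : ℝ)
  /-- `‖σ_ν² 1 + σ_ε² d⁻¹‖_∞ / ‖σ_ν² 1 + σ_ε² d⁻¹‖_2 → 0`. -/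
  balanced : Tendsto (fun n => ‖(D n).noiseVar σν2 σε2‖ /
    ‖WithLp.toLp 2 ((D n).noiseVar σν2 σε2)‖) atTop (𝓝 0)
  /-- `2 n ‖σ_ν² 1 + σ_ε² d⁻¹‖_2² / (Tr D⁻¹)² → σ_a²`. -/
  tendsto_σa2 : Tendsto (fun n : ℕ => 2 * (n : ℝ) *
    ‖WithLp.toLp 2 ((D n).noiseVar σν2 σε2)‖ ^ 2 / (D n).Dinv.trace ^ 2) atTop (𝓝 σa2)
  /-- `n_a / Tr D⁻¹ → d̄`. -/
  tendsto_dbar : Tendsto (fun n => (na n : ℝ) / (D n).Dinv.trace) atTop (𝓝 dbar)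

end

end MixedModel

set_option linter.unusedSectionVars false

namespace MixedModel

open scoped RealInnerProductSpace Matrix MatrixOrder

/-! ### Gaussian vectors: linear images, sums and concentration of the squared norm. -/

section Gaussian

variable {ι κ : Type*} [Fintype ι] [Fintype κ] [DecidableEq ι] [DecidableEq κ]

/-! Since `Q W = 0`, the estimators see the data only through `Q Y = Q μ + Q ξ` with Gaussian noise
`ξ = Z ν + ε`. The exponential weights are a Gibbs distribution, so their averaged residual sum of
squares exceeds the smallest one by at most `α` times the entropy, hence by at most `α u log p`.
This yields the pathwise oracle inequality `norm_sub_expWeightEstimator_sq_le`: the squared error of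
the fit to `Q μ` is bounded, up to constants, by the approximation error of any competing model, by
`α u log p`, and by the largest squared projection of `Q ξ` onto a space spanned by `u` columns and
`Q μ`. The last term is a maximum over at most `p ^ u` spaces of dimension at most `u + 1`, so an
exponential tail bound and a union bound make it `o(√n)` in probability. With weak sparsity the
whole fit error is `o(√n)` in squared norm.

The residual is noise plus fit error. By Chebyshev, `‖B ξ‖² / n_b` tends to `σ_ε²` and the whitened
noise, divided by `Tr D⁻¹`, tends to `σ_ν² d̄ + σ_ε²`. Whitening inflates the squared fit error by
at most `max d_k⁻¹ ≤ ‖ω‖_∞ / σ_ε² = o(√n)`, which together with the rate `√n` of the fit error is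
negligible against `Tr D⁻¹`, of order `n`. So `σ̂_ε²` tends to `σ_ε²` and `σ̂_ν²` to `σ_ν² d̄`;
division by `d̂` removes the factor `d̄`, and the plug-in vector is close to `ω` in Euclidean norm.

The limit arguments are deterministic, along any filter `l ≤ atTop`; convergence in probability is
reduced to them by almost surely convergent subsequences. Random designs are frozen by independence
in `tendstoInMeasure_of_forall_ae_indep`. -/

theorem inner_toEuclideanLin_left (M : Matrix κ ι ℝ) (x : EuclideanSpace ℝ ι)
    (t : EuclideanSpace ℝ κ) :
    ⟪M.toEuclideanLin x, t⟫ = ⟪x, M.transpose.toEuclideanLin t⟫ := by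
  have := Matrix.toEuclideanLin_conjTranspose_eq_adjoint (𝕜 := ℝ) M
  rw [Matrix.conjTranspose_eq_transpose_of_trivial] at this
  rw [this, LinearMap.adjoint_inner_right]

theorem toEuclideanLin_mul_apply {τ : Type*} [Fintype τ] [DecidableEq τ]
    (M : Matrix κ ι ℝ) (N : Matrix ι τ ℝ)
    (x : EuclideanSpace ℝ τ) :
    (M * N).toEuclideanLin x = M.toEuclideanLin (N.toEuclideanLin x) := by
  ext i
  simp [Matrix.toLpLin_apply]

theorem measurable_toEuclideanLin (M : Matrix κ ι ℝ) :
    Measurable fun x : EuclideanSpace ℝ ι => M.toEuclideanLin x :=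
  (LinearMap.continuous_of_finiteDimensional M.toEuclideanLin).measurable

theorem charFun_map_toEuclideanLin (μ : Measure (EuclideanSpace ℝ ι)) (M : Matrix κ ι ℝ)
    (t : EuclideanSpace ℝ κ) :
    charFun (μ.map fun x => M.toEuclideanLin x) t
      = charFun μ (M.transpose.toEuclideanLin t) := by
  rw [charFun_apply, charFun_apply,
    integral_map (measurable_toEuclideanLin M).aemeasurable
      (by fun_prop)]
  simp_rw [inner_toEuclideanLin_left]

/-- Characteristic functions identify the law without requiring a density, so `S` and `M * S * Mᵀ`
may be singular. -/
theorem hasLaw_toEuclideanLin {Ω : Type*} [MeasurableSpace Ω] {P : Measure Ω}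
    {X : Ω → EuclideanSpace ℝ ι} {S : Matrix ι ι ℝ} (hS : S.PosSemidef)
    (hX : HasLaw X (multivariateGaussian 0 S) P) (M : Matrix κ ι ℝ) :
    HasLaw (fun ω => M.toEuclideanLin (X ω))
      (multivariateGaussian 0 (M * S * M.transpose)) P := by
  refine ⟨(measurable_toEuclideanLin M).comp_aemeasurable hX.aemeasurable, ?_⟩
  have hS' : (M * S * M.transpose).PosSemidef := by
    simpa using hS.mul_mul_conjTranspose_same M
  have h : P.map (fun ω => M.toEuclideanLin (X ω))
      = (multivariateGaussian 0 S).map fun x => M.toEuclideanLin x := by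
    rw [← hX.map_eq, AEMeasurable.map_map_of_aemeasurable
      (measurable_toEuclideanLin M).aemeasurable hX.aemeasurable]
    rfl
  rw [h]
  have := Measure.isProbabilityMeasure_map (μ := multivariateGaussian 0 S)
    (measurable_toEuclideanLin M).aemeasurable
  apply Measure.ext_of_charFun
  ext t
  rw [charFun_map_toEuclideanLin, charFun_multivariateGaussian hS,
    charFun_multivariateGaussian hS']
  congr 1
  simp only [inner_zero_right, Complex.ofReal_zero, zero_mul, Matrix.toLpLin_apply]
  congr 3
  simp only [← Matrix.mulVec_mulVec, Matrix.dotProduct_mulVec, Matrix.mulVec_transpose]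

theorem hasLaw_add_multivariateGaussian {Ω : Type*} [MeasurableSpace Ω] {P : Measure Ω}
    [IsProbabilityMeasure P] {X Y : Ω → EuclideanSpace ℝ ι} {S T : Matrix ι ι ℝ}
    (hS : S.PosSemidef) (hT : T.PosSemidef)
    (hX : HasLaw X (multivariateGaussian 0 S) P) (hY : HasLaw Y (multivariateGaussian 0 T) P)
    (hXY : IndepFun X Y P) :
    HasLaw (fun ω => X ω + Y ω) (multivariateGaussian 0 (S + T)) P := by
  refine ⟨hX.aemeasurable.add hY.aemeasurable, ?_⟩
  have := Measure.isProbabilityMeasure_map (hX.aemeasurable.add hY.aemeasurable)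
  apply Measure.ext_of_charFun
  ext t
  have h := congrFun (hXY.charFun_map_add_eq_mul hX.aemeasurable hY.aemeasurable) t
  change charFun (P.map (X + Y)) t = _
  rw [h, Pi.mul_apply, hX.map_eq, hY.map_eq, charFun_multivariateGaussian hS,
    charFun_multivariateGaussian hT, charFun_multivariateGaussian (hS.add hT), ← Complex.exp_add]
  congr 1
  simp [Matrix.add_mulVec]
  ring

/-- Rescaling independent standard normals turns the squared norm into a weighted sum of independent
squares, whose variance is computable. -/
theorem multivariateGaussian_diagonal (w : ι → ℝ) (hw : ∀ i, 0 ≤ w i) :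
    multivariateGaussian 0 (Matrix.diagonal w) =
      (Measure.pi fun _ : ι => gaussianReal 0 1).map
        fun g => WithLp.toLp 2 fun i => Real.sqrt (w i) * g i := by
  have h := hasLaw_toEuclideanLin (P := multivariateGaussian 0 (1 : Matrix ι ι ℝ)) (X := id)
    Matrix.PosSemidef.one ⟨by fun_prop, by simp⟩ (Matrix.diagonal fun i => Real.sqrt (w i))
  have h2 : (Matrix.diagonal fun i => Real.sqrt (w i)) * 1
      * (Matrix.diagonal fun i => Real.sqrt (w i)).transpose = Matrix.diagonal w := by
    simp [Matrix.diagonal_mul_diagonal, Real.mul_self_sqrt (hw _)]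
  rw [h2] at h
  rw [← h.map_eq, multivariateGaussian_zero_one, ← map_pi_eq_stdGaussian, Measure.map_map]
  · congr 1
    ext g i
    simp [Matrix.toLpLin_apply, Matrix.mulVec_diagonal]
  · exact measurable_toEuclideanLin _
  · fun_prop

theorem memLp_sq_gaussianReal : MemLp (fun x : ℝ => x ^ 2) 2 (gaussianReal 0 1) := by
  have h : MemLp (id : ℝ → ℝ) 4 (gaussianReal 0 1) := IsGaussian.memLp_id _ 4 (by simp)
  refine (memLp_two_iff_integrable_sq (by fun_prop)).2 ?_
  have := h.integrable_norm_pow (p := 4) (by simp)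
  refine this.congr (ae_of_all _ fun x => ?_)
  simp only [id_eq, Real.norm_eq_abs]
  rw [← pow_mul, Even.pow_abs (by decide)]

theorem integral_sq_gaussianReal : ∫ x : ℝ, x ^ 2 ∂gaussianReal 0 1 = 1 := by
  have h := variance_id_gaussianReal (μ := 0) (v := 1)
  rw [variance_of_integral_eq_zero (by fun_prop) (by simp)] at h
  simpa using h

/-- Chebyshev's inequality for the squared norm of a centred Gaussian vector with
independent coordinates. -/
theorem measure_norm_sq_sub_ge_le {Ω : Type*} [MeasurableSpace Ω] {P : Measure Ω}
    {X : Ω → EuclideanSpace ℝ ι} {w : ι → ℝ} (hw : ∀ i, 0 ≤ w i)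
    (hX : HasLaw X (multivariateGaussian 0 (Matrix.diagonal w)) P) {t : ℝ} (ht : 0 < t) :
    P {ω | t ≤ |‖X ω‖ ^ 2 - ∑ i, w i|} ≤ ENNReal.ofReal
      (Var[fun x : ℝ => x ^ 2; gaussianReal 0 1] * (∑ i, w i ^ 2) / t ^ 2) := by
  have hset : MeasurableSet {x : EuclideanSpace ℝ ι | t ≤ |‖x‖ ^ 2 - ∑ i, w i|} :=
    measurableSet_le measurable_const (by fun_prop)
  have h1 : P {ω | t ≤ |‖X ω‖ ^ 2 - ∑ i, w i|}
      = P.map X {x : EuclideanSpace ℝ ι | t ≤ |‖x‖ ^ 2 - ∑ i, w i|} := by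
    rw [Measure.map_apply_of_aemeasurable hX.aemeasurable hset]
    rfl
  rw [h1, hX.map_eq, multivariateGaussian_diagonal w hw,
    Measure.map_apply (by fun_prop) hset]
  -- The squared norm as a sum of independent terms `w i * g i ^ 2`, with mean `∑ w i` and variance
  -- proportional to `∑ w i ^ 2`.
  let F : (ι → ℝ) → ℝ := ∑ i, fun g : ι → ℝ => (fun x : ℝ => w i * x ^ 2) (g i)
  have hmem : ∀ i, MemLp (fun x : ℝ => w i * x ^ 2) 2 (gaussianReal 0 1) := fun i =>
    memLp_sq_gaussianReal.const_mul (w i)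
  have hmem' : ∀ i, MemLp (fun g : ι → ℝ => w i * (g i) ^ 2) 2
      (Measure.pi fun _ : ι => gaussianReal 0 1) := fun i =>
    (hmem i).comp_measurePreserving (measurePreserving_eval _ i)
  have hF : MemLp F 2 (Measure.pi fun _ : ι => gaussianReal 0 1) :=
    memLp_finsetSum' _ fun i _ => hmem' i
  have hvar : Var[F; Measure.pi fun _ : ι => gaussianReal 0 1]
      = Var[fun x : ℝ => x ^ 2; gaussianReal 0 1] * ∑ i, w i ^ 2 := by
    rw [variance_sum_pi hmem, Finset.mul_sum]
    refine Finset.sum_congr rfl fun i _ => ?_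
    rw [variance_const_mul, mul_comm]
  have hmean : ∫ g, F g ∂(Measure.pi fun _ : ι => gaussianReal 0 1) = ∑ i, w i := by
    simp only [F, Finset.sum_apply]
    rw [integral_finsetSum _ fun i _ => (hmem' i).integrable (by norm_num)]
    refine Finset.sum_congr rfl fun i _ => ?_
    rw [integral_const_mul, integral_comp_eval (μ := fun _ : ι => gaussianReal 0 1)
      (f := fun x : ℝ => x ^ 2) (by fun_prop), integral_sq_gaussianReal, mul_one]
  have := meas_ge_le_variance_div_sq hF ht
  rw [hvar, hmean] at this
  refine le_trans (le_of_eq ?_) this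
  congr 1
  ext g
  simp [F, EuclideanSpace.real_norm_sq_eq, mul_pow, Real.sq_sqrt (hw _)]

end Gaussian

/-! ### Exponential tails for projections of Gaussian vectors. -/

section Tail

theorem map_orthogonalProjection_stdGaussian {E : Type*} [NormedAddCommGroup E]
    [InnerProductSpace ℝ E] [FiniteDimensional ℝ E] [MeasurableSpace E] [BorelSpace E]
    (W : Submodule ℝ E) :
    (stdGaussian E).map W.orthogonalProjectionOnto = stdGaussian W := by
  have := Measure.isProbabilityMeasure_map (μ := stdGaussian E) (f := W.orthogonalProjectionOnto)
    (by fun_prop)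
  apply Measure.ext_of_charFun
  ext t
  rw [charFun_apply, integral_map (by fun_prop) (by fun_prop), charFun_stdGaussian]
  have h : ∀ x : E, ⟪W.orthogonalProjectionOnto x, t⟫ = ⟪x, (t : E)⟫ := fun x => by
    simp
  simp_rw [h]
  rw [← charFun_apply, charFun_stdGaussian]
  simp

/-- In an orthonormal basis the exponential of the squared norm is a product of functions of
independent coordinates, so the dimension enters only as an exponent. -/
theorem integral_exp_norm_sq_stdGaussian {E : Type*} [NormedAddCommGroup E]
    [InnerProductSpace ℝ E] [FiniteDimensional ℝ E] [MeasurableSpace E] [BorelSpace E]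
    {c : ℝ} (hc : Integrable (fun x : ℝ => Real.exp (c * x ^ 2)) (gaussianReal 0 1)) :
    Integrable (fun x : E => Real.exp (c * ‖x‖ ^ 2)) (stdGaussian E) ∧
    ∫ x : E, Real.exp (c * ‖x‖ ^ 2) ∂stdGaussian E
      = (∫ x : ℝ, Real.exp (c * x ^ 2) ∂gaussianReal 0 1) ^ Module.finrank ℝ E := by
  have hm : Measurable fun x : Fin (Module.finrank ℝ E) → ℝ =>
      ∑ i, x i • stdOrthonormalBasis ℝ E i := by fun_prop
  have hnorm : ∀ x : Fin (Module.finrank ℝ E) → ℝ,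
      Real.exp (c * ‖∑ i, x i • stdOrthonormalBasis ℝ E i‖ ^ 2)
        = ∏ i, Real.exp (c * x i ^ 2) := fun x => by
    rw [← Real.exp_sum, ← Finset.mul_sum,
      ← (stdOrthonormalBasis ℝ E).sum_sq_norm_inner_right]
    congr 2
    refine Finset.sum_congr rfl fun i _ => ?_
    rw [(stdOrthonormalBasis ℝ E).orthonormal.inner_right_fintype]
    simp
  constructor
  · rw [stdGaussian, integrable_map_measure (by fun_prop) hm.aemeasurable]
    simp only [Function.comp_def, hnorm]
    exact Integrable.fintype_prod fun _ => hc
  · rw [stdGaussian, integral_map hm.aemeasurable (by fun_prop)]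
    simp_rw [hnorm]
    rw [integral_fintype_prod_eq_prod (f := fun _ x => Real.exp (c * x ^ 2))]
    simp

theorem measure_norm_sq_stdGaussian_ge_le {E : Type*} [NormedAddCommGroup E]
    [InnerProductSpace ℝ E] [FiniteDimensional ℝ E] [MeasurableSpace E] [BorelSpace E]
    {c : ℝ} (hc0 : 0 < c)
    (hc : Integrable (fun x : ℝ => Real.exp (c * x ^ 2)) (gaussianReal 0 1)) (t : ℝ) :
    (stdGaussian E).real {x | t ≤ ‖x‖ ^ 2} ≤
      (∫ x : ℝ, Real.exp (c * x ^ 2) ∂gaussianReal 0 1) ^ Module.finrank ℝ E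
        * Real.exp (-(c * t)) := by
  obtain ⟨h1, h2⟩ := integral_exp_norm_sq_stdGaussian (E := E) hc
  have := measure_ge_le_exp_mul_mgf (μ := stdGaussian E) (X := fun x => ‖x‖ ^ 2) t hc0.le h1
  rw [mgf, h2, mul_comm] at this
  simpa using this

theorem one_le_integral_exp_sq {c : ℝ} (hc0 : 0 < c)
    (hc : Integrable (fun x : ℝ => Real.exp (c * x ^ 2)) (gaussianReal 0 1)) :
    1 ≤ ∫ x : ℝ, Real.exp (c * x ^ 2) ∂gaussianReal 0 1 := by
  calc (1 : ℝ) = ∫ _ : ℝ, (1 : ℝ) ∂gaussianReal 0 1 := by simp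
    _ ≤ _ := integral_mono (integrable_const _) hc fun x => Real.one_le_exp (by positivity)

/-- The projection of `L x` onto `U` depends on `x` only through its inner products with `L* U`, a
space of no larger dimension. This replaces coloured noise by standard Gaussian noise on a small
space, at the cost of the factor `l`. -/
theorem norm_starProjection_apply_le {E F : Type*} [NormedAddCommGroup E]
    [InnerProductSpace ℝ E] [FiniteDimensional ℝ E] [NormedAddCommGroup F]
    [InnerProductSpace ℝ F] [FiniteDimensional ℝ F] (L : E →ₗ[ℝ] F) (U : Submodule ℝ F)
    {l : ℝ} (hl : 0 ≤ l) (hL : ∀ y, ‖LinearMap.adjoint L y‖ ^ 2 ≤ l * ‖y‖ ^ 2) (x : E) :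
    ‖U.starProjection (L x)‖ ^ 2 ≤ l *
      ‖(U.map (LinearMap.adjoint L)).orthogonalProjectionOnto x‖ ^ 2 := by
  set W := U.map (LinearMap.adjoint L)
  set y := U.starProjection (L x)
  have hyU : y ∈ U := U.starProjection_apply_mem _
  have hW : LinearMap.adjoint L y ∈ W := ⟨y, hyU, rfl⟩
  have h1 : ‖y‖ ^ 2 = ⟪LinearMap.adjoint L y, (W.orthogonalProjectionOnto x : E)⟫ := by
    have h2 : ⟪LinearMap.adjoint L y, W.starProjection x⟫ = ⟪LinearMap.adjoint L y, x⟫ := by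
      rw [← W.inner_starProjection_left_eq_right, W.starProjection_eq_self_iff.2 hW]
    rw [← W.starProjection_apply, h2, LinearMap.adjoint_inner_left,
      ← real_inner_self_eq_norm_sq]
    calc ⟪y, y⟫ = ⟪y, U.starProjection (L x)⟫ := rfl
      _ = ⟪y, L x⟫ := by
        rw [← U.inner_starProjection_left_eq_right, U.starProjection_eq_self_iff.2 hyU]
  have h2 := real_inner_le_norm (LinearMap.adjoint L y) (W.orthogonalProjectionOnto x : E)
  rw [← h1, ← Submodule.coe_norm] at h2
  change _ ≤ l * ‖W.orthogonalProjectionOnto x‖ ^ 2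
  rcases (norm_nonneg y).eq_or_lt with h0 | h0
  · rw [← h0, zero_pow two_ne_zero]
    positivity
  -- Cauchy–Schwarz applied to `‖y‖² = ⟪L* y, P x⟫`, squared; one factor `‖y‖²` is then cancelled.
  · have h3 : (‖y‖ ^ 2) * ‖y‖ ^ 2 ≤ ‖y‖ ^ 2 * (l * ‖W.orthogonalProjectionOnto x‖ ^ 2) := by
      calc (‖y‖ ^ 2) * ‖y‖ ^ 2
          ≤ (‖LinearMap.adjoint L y‖ * ‖W.orthogonalProjectionOnto x‖)
            * (‖LinearMap.adjoint L y‖ * ‖W.orthogonalProjectionOnto x‖) := by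
            gcongr
        _ = ‖LinearMap.adjoint L y‖ ^ 2 * ‖W.orthogonalProjectionOnto x‖ ^ 2 := by ring
        _ ≤ (l * ‖y‖ ^ 2) * ‖W.orthogonalProjectionOnto x‖ ^ 2 := by gcongr; exact hL y
        _ = _ := by ring
    exact le_of_mul_le_mul_left h3 (by positivity)

/-- Exponential tail bound for the projection of a centred Gaussian vector onto a subspace. -/
theorem measure_norm_sq_starProjection_ge_le {ι : Type*} [Fintype ι] [DecidableEq ι]
    {Ω : Type*} [MeasurableSpace Ω] {P : Measure Ω} {X : Ω → EuclideanSpace ℝ ι}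
    {S : Matrix ι ι ℝ} (hS : S.PosSemidef) (hX : HasLaw X (multivariateGaussian 0 S) P)
    {l : ℝ} (hl : 0 < l) (hSl : ∀ x : EuclideanSpace ℝ ι, ⟪x, S.toEuclideanLin x⟫ ≤ l * ‖x‖ ^ 2)
    (U : Submodule ℝ (EuclideanSpace ℝ ι)) {k : ℕ} (hU : Module.finrank ℝ U ≤ k)
    {c : ℝ} (hc0 : 0 < c)
    (hc : Integrable (fun x : ℝ => Real.exp (c * x ^ 2)) (gaussianReal 0 1)) (t : ℝ) :
    P {ω | t ≤ ‖U.starProjection (X ω)‖ ^ 2} ≤ ENNReal.ofReal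
      ((∫ x : ℝ, Real.exp (c * x ^ 2) ∂gaussianReal 0 1) ^ k * Real.exp (-(c * (t / l)))) := by
  have hset : MeasurableSet {x : EuclideanSpace ℝ ι | t ≤ ‖U.starProjection x‖ ^ 2} :=
    measurableSet_le measurable_const (by fun_prop)
  have h1 : P {ω | t ≤ ‖U.starProjection (X ω)‖ ^ 2}
      = P.map X {x | t ≤ ‖U.starProjection x‖ ^ 2} := by
    rw [Measure.map_apply_of_aemeasurable hX.aemeasurable hset]
    rfl
  -- The Gaussian vector is `R` applied to a standard one, with `R` the self-adjoint square root of
  -- `S`; the quadratic form bound on `S` is the bound on `‖R y‖²`.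
  let R := Matrix.toEuclideanCLM (𝕜 := ℝ) (CFC.sqrt S)
  have hRadj : ContinuousLinearMap.adjoint R = R :=
    IsSelfAdjoint.adjoint_eq ((CFC.sqrt_nonneg S).isSelfAdjoint.map _)
  have hRR : ∀ x, R (R x) = S.toEuclideanLin x := fun x => by
    rw [← mul_apply_eq_comp, ← map_mul, CFC.sqrt_mul_sqrt_self _ hS.nonneg]
    rfl
  let L : EuclideanSpace ℝ ι →ₗ[ℝ] EuclideanSpace ℝ ι := R
  have hLadj : ∀ x, LinearMap.adjoint L x = R x := fun x => by
    conv_rhs => rw [← hRadj]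
    rfl
  have hL : ∀ y, ‖LinearMap.adjoint L y‖ ^ 2 ≤ l * ‖y‖ ^ 2 := fun y => by
    refine le_trans (le_of_eq ?_) (hSl y)
    rw [hLadj, ← hRR, ← ContinuousLinearMap.adjoint_inner_left, hRadj,
      real_inner_self_eq_norm_sq]
  rw [h1, hX.map_eq, multivariateGaussian,
    Measure.map_apply (by fun_prop) hset]
  set W := U.map (LinearMap.adjoint L)
  have hW : Module.finrank ℝ W ≤ k := (Submodule.finrank_map_le _ _).trans hU
  have hset' : MeasurableSet {w : W | t / l ≤ ‖w‖ ^ 2} :=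
    measurableSet_le measurable_const (by fun_prop)
  calc _ ≤ stdGaussian (EuclideanSpace ℝ ι)
        (W.orthogonalProjectionOnto ⁻¹' {w : W | t / l ≤ ‖w‖ ^ 2}) := by
        refine measure_mono fun x hx => ?_
        simp only [Set.mem_preimage, Set.mem_ofPred_eq, zero_add] at hx ⊢
        rw [div_le_iff₀' hl]
        exact hx.trans (norm_starProjection_apply_le L U hl.le hL x)
    _ = stdGaussian W {w : W | t / l ≤ ‖w‖ ^ 2} := by
        rw [← map_orthogonalProjection_stdGaussian, Measure.map_apply (by fun_prop) hset']
    _ = ENNReal.ofReal ((stdGaussian W).real {w : W | t / l ≤ ‖w‖ ^ 2}) := by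
        rw [ofReal_measureReal]
    _ ≤ _ := by
        refine ENNReal.ofReal_le_ofReal ((measure_norm_sq_stdGaussian_ge_le hc0 hc _).trans ?_)
        gcongr
        exact one_le_integral_exp_sq hc0 hc

theorem inner_toEuclideanLin_le_lambdaMax {ι : Type*} [Fintype ι] [DecidableEq ι]
    {S : Matrix ι ι ℝ} (hS : S.IsHermitian) (x : EuclideanSpace ℝ ι) :
    ⟪x, S.toEuclideanLin x⟫ ≤ lambdaMax S * ‖x‖ ^ 2 := by
  have hle : ∀ i, hS.eigenvalues i ≤ lambdaMax S := fun i => by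
    rw [lambdaMax, hS.spectrum_real_eq_range_eigenvalues]
    exact le_csSup (Set.finite_range _).bddAbove ⟨i, rfl⟩
  let b := hS.eigenvectorBasis
  have hb : ∀ i, ⟪b i, S.toEuclideanLin x⟫ = hS.eigenvalues i * ⟪b i, x⟫ := fun i => by
    have h := hS.mulVec_eigenvectorBasis i
    have hT : S.transpose = S := by simpa using hS.eq
    rw [real_inner_comm, inner_toEuclideanLin_left, hT]
    have : S.toEuclideanLin (b i) = hS.eigenvalues i • b i := by
      ext j
      exact congrFun h j
    rw [this, real_inner_smul_right, real_inner_comm]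
  rw [← b.sum_inner_mul_inner, ← b.sum_sq_norm_inner_right, Finset.mul_sum]
  refine Finset.sum_le_sum fun i _ => ?_
  rw [hb, real_inner_comm]
  have := mul_le_mul_of_nonneg_right (hle i) (sq_nonneg ⟪b i, x⟫)
  simp only [Real.norm_eq_abs, sq_abs]
  linarith

end Tail

/-! ### Exponential weights and the oracle inequality. -/

section Oracle

variable {ι : Type*} [Fintype ι] {p : ℕ}

theorem toEuclideanLin_apply_eq_sum (M : Matrix ι (Fin p) ℝ) (b : EuclideanSpace ℝ (Fin p)) :
    M.toEuclideanLin b = ∑ j, b j • WithLp.toLp 2 (fun i => M i j) := by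
  ext i
  simp [Matrix.toLpLin_apply, Matrix.mulVec, dotProduct, mul_comm]

theorem mem_colSpan_iff (M : Matrix ι (Fin p) ℝ) (m : Finset (Fin p)) (z : EuclideanSpace ℝ ι) :
    z ∈ colSpan M m ↔ ∃ b, SupportedOn m b ∧ M.toEuclideanLin b = z := by
  constructor
  · intro hz
    induction hz using Submodule.span_induction with
    | mem x hx =>
      obtain ⟨j, hj, rfl⟩ := hx
      refine ⟨EuclideanSpace.single j 1, fun k hk => ?_, ?_⟩
      · have : k ≠ j := fun h => hk (h ▸ hj)
        simp [this]
      · rw [toEuclideanLin_apply_eq_sum]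
        simp
    | zero => exact ⟨0, fun j _ => by simp, by simp⟩
    | add x y _ _ hx hy =>
      obtain ⟨b, hb, rfl⟩ := hx
      obtain ⟨c, hc, rfl⟩ := hy
      exact ⟨b + c, fun j hj => by simp [hb j hj, hc j hj], by simp⟩
    | smul a x _ hx =>
      obtain ⟨b, hb, rfl⟩ := hx
      exact ⟨a • b, fun j hj => by simp [hb j hj], by simp⟩
  · rintro ⟨b, hb, rfl⟩
    rw [toEuclideanLin_apply_eq_sum]
    refine Submodule.sum_mem _ fun j _ => ?_
    by_cases hj : j ∈ m
    · exact Submodule.smul_mem _ _ (Submodule.subset_span ⟨j, hj, rfl⟩)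
    · simp [hb j hj]

theorem finrank_colSpan_le (M : Matrix ι (Fin p) ℝ) (m : Finset (Fin p)) :
    Module.finrank ℝ (colSpan M m) ≤ m.card := by
  classical
  rw [colSpan, ← Finset.coe_image]
  exact (finrank_span_finset_le_card _).trans Finset.card_image_le

theorem norm_sub_starProjection_le {E : Type*} [NormedAddCommGroup E] [InnerProductSpace ℝ E]
    (K : Submodule ℝ E) [K.HasOrthogonalProjection] (y : E) {z : E} (hz : z ∈ K) :
    ‖y - K.starProjection y‖ ≤ ‖y - z‖ := by
  rw [K.starProjection_minimal]
  exact ciInf_le ⟨0, by rintro _ ⟨x, rfl⟩; positivity⟩ (⟨z, hz⟩ : K)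

theorem norm_sub_sq_eq_starProjection {E : Type*} [NormedAddCommGroup E] [InnerProductSpace ℝ E]
    (K : Submodule ℝ E) [K.HasOrthogonalProjection] (y : E) {z : E} (hz : z ∈ K) :
    ‖y - z‖ ^ 2 = ‖y - K.starProjection y‖ ^ 2 + ‖K.starProjection y - z‖ ^ 2 := by
  have h : ⟪y - K.starProjection y, K.starProjection y - z⟫ = 0 :=
    K.starProjection_inner_eq_zero _ _ (K.sub_mem (K.starProjection_apply_mem y) hz)
  have := norm_add_sq_real (y - K.starProjection y) (K.starProjection y - z)
  rw [h, sub_add_sub_cancel] at this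
  linarith

/-- The fitted vector of least squares is the orthogonal projection onto the column span. -/
theorem toEuclideanLin_leastSquares (M : Matrix ι (Fin p) ℝ) (y : EuclideanSpace ℝ ι)
    (m : Finset (Fin p)) :
    M.toEuclideanLin (leastSquares M y m) = (colSpan M m).starProjection y := by
  obtain ⟨h1, h2⟩ := (exists_isLeastSquares M y m).choose_spec
  change SupportedOn m (leastSquares M y m) at h1
  set b := leastSquares M y m
  have hb : M.toEuclideanLin b ∈ colSpan M m := (mem_colSpan_iff _ _ _).2 ⟨b, h1, rfl⟩
  obtain ⟨b', hb', hb''⟩ := (mem_colSpan_iff M m _).1 ((colSpan M m).starProjection_apply_mem y)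
  have h3 : ‖y - M.toEuclideanLin b‖ ≤ ‖y - (colSpan M m).starProjection y‖ :=
    hb'' ▸ h2 b' hb'
  have h4 := norm_sub_sq_eq_starProjection (colSpan M m) y hb
  have h5 : ‖y - M.toEuclideanLin b‖ ^ 2 ≤ ‖y - (colSpan M m).starProjection y‖ ^ 2 := by
    gcongr
  have h6 : ‖(colSpan M m).starProjection y - M.toEuclideanLin b‖ = 0 :=
    pow_eq_zero_iff two_ne_zero |>.1 (le_antisymm (by linarith) (by positivity))
  exact (sub_eq_zero.1 (norm_eq_zero.1 h6)).symm

theorem models_nonempty {p u : ℕ} (hu : u ≤ p) : (models p u).Nonempty :=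
  Finset.powersetCard_nonempty.2 (by simpa using hu)

theorem sum_rawWeight_pos (M : Matrix ι (Fin p) ℝ) (y : EuclideanSpace ℝ ι) (α : ℝ) {u : ℕ}
    (hu : u ≤ p) : 0 < ∑ k ∈ models p u, rawWeight M y α k :=
  Finset.sum_pos (fun _ _ => Real.exp_pos _) (models_nonempty hu)

theorem expWeight_pos (M : Matrix ι (Fin p) ℝ) (y : EuclideanSpace ℝ ι) (α : ℝ) {u : ℕ}
    (hu : u ≤ p) (m : Finset (Fin p)) : 0 < expWeight M y α u m :=
  div_pos (Real.exp_pos _) (sum_rawWeight_pos M y α hu)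

theorem sum_expWeight (M : Matrix ι (Fin p) ℝ) (y : EuclideanSpace ℝ ι) (α : ℝ) {u : ℕ}
    (hu : u ≤ p) : ∑ m ∈ models p u, expWeight M y α u m = 1 := by
  simp_rw [expWeight]
  rw [← Finset.sum_div, div_self (sum_rawWeight_pos M y α hu).ne']

/-- Entropy bound: a probability vector on a finite set has entropy at most `log` of the
cardinality. -/
theorem sum_neg_mul_log_le {τ : Type*} (s : Finset τ) (w : τ → ℝ) (hw : ∀ m ∈ s, 0 < w m)
    (hsum : ∑ m ∈ s, w m = 1) (hs : s.Nonempty) :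
    ∑ m ∈ s, -(w m * Real.log (w m)) ≤ Real.log s.card := by
  have hN : (0 : ℝ) < s.card := by exact_mod_cast hs.card_pos
  have h : ∀ m ∈ s, -(w m * Real.log (w m)) ≤ w m * Real.log s.card + (1 / s.card - w m) :=
    fun m hm => by
      -- Gibbs' inequality against the uniform distribution: `log x ≤ x - 1` at `x = 1 / (w m * N)`;
      -- the remainders `1 / N - w m` sum to zero.
      have h1 := Real.log_le_sub_one_of_pos (x := 1 / (w m * s.card))
        (by have := hw m hm; positivity)
      rw [one_div, Real.log_inv, Real.log_mul (hw m hm).ne' hN.ne'] at h1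
      have h2 := mul_le_mul_of_nonneg_left h1 (hw m hm).le
      have h3 : w m * ((w m * s.card)⁻¹ - 1) = 1 / s.card - w m := by
        have := (hw m hm).ne'
        field_simp
      rw [h3] at h2
      linarith
  refine (Finset.sum_le_sum h).trans (le_of_eq ?_)
  rw [Finset.sum_add_distrib, Finset.sum_sub_distrib, ← Finset.sum_mul, hsum]
  simp [hN.ne']

/-- Exponential weights nearly minimise the averaged residual sum of squares. -/
theorem sum_expWeight_mul_rss_le (M : Matrix ι (Fin p) ℝ) (y : EuclideanSpace ℝ ι) {α : ℝ}
    (hα : 0 < α) {u : ℕ} (hu : u ≤ p) {m' : Finset (Fin p)} (hm' : m' ∈ models p u) :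
    ∑ m ∈ models p u, expWeight M y α u m * ‖y - (colSpan M m).starProjection y‖ ^ 2
      ≤ ‖y - (colSpan M m').starProjection y‖ ^ 2 + α * Real.log (models p u).card := by
  set Zs := ∑ k ∈ models p u, rawWeight M y α k with hZ
  have hZpos : 0 < Zs := sum_rawWeight_pos M y α hu
  have hraw : ∀ m, Real.log (rawWeight M y α m)
      = -(1 / α) * ‖y - (colSpan M m).starProjection y‖ ^ 2 := fun m => by
    rw [rawWeight, Real.log_exp, toEuclideanLin_leastSquares]
  -- Solving the definition of the weight for the residual sum of squares; averaging gives `α` times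
  -- the entropy minus `α log Zs`.
  have h1 : ∀ m, ‖y - (colSpan M m).starProjection y‖ ^ 2
      = -(α * Real.log (expWeight M y α u m)) - α * Real.log Zs := fun m => by
    rw [expWeight, ← hZ, Real.log_div (show rawWeight M y α m ≠ 0 from (Real.exp_pos _).ne')
      hZpos.ne', hraw]
    field_simp
    ring
  -- The normaliser is at least its single summand for `m'`.
  have h2 : -(α * Real.log Zs) ≤ ‖y - (colSpan M m').starProjection y‖ ^ 2 := by
    have h3 : Real.log (rawWeight M y α m') ≤ Real.log Zs :=
      Real.log_le_log (Real.exp_pos _)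
        (Finset.single_le_sum (f := rawWeight M y α) (fun _ _ => (Real.exp_pos _).le) hm')
    rw [hraw] at h3
    have h4 := mul_le_mul_of_nonneg_left h3 hα.le
    have h5 : α * (-(1 / α) * ‖y - (colSpan M m').starProjection y‖ ^ 2)
        = -‖y - (colSpan M m').starProjection y‖ ^ 2 := by field_simp
    linarith
  have h3 : ∑ m ∈ models p u, expWeight M y α u m * ‖y - (colSpan M m).starProjection y‖ ^ 2
      = α * (∑ m ∈ models p u, -(expWeight M y α u m * Real.log (expWeight M y α u m)))
        - α * Real.log Zs := by
    have : α * Real.log Zs = ∑ m ∈ models p u, expWeight M y α u m * (α * Real.log Zs) := by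
      rw [← Finset.sum_mul, sum_expWeight M y α hu, one_mul]
    rw [this, Finset.mul_sum, ← Finset.sum_sub_distrib]
    refine Finset.sum_congr rfl fun m _ => ?_
    rw [h1]
    ring
  have h4 := sum_neg_mul_log_le (models p u) (expWeight M y α u)
    (fun m _ => expWeight_pos M y α hu m) (sum_expWeight M y α hu) (models_nonempty hu)
  have h5 := mul_le_mul_of_nonneg_left h4 hα.le
  linarith

theorem card_models_le (p u : ℕ) : ((models p u).card : ℝ) ≤ (p : ℝ) ^ u := by
  rw [models, Finset.card_powersetCard, Finset.card_univ, Fintype.card_fin]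
  exact_mod_cast Nat.choose_le_pow p u

theorem log_card_models_le {p u : ℕ} (hu : u ≤ p) :
    Real.log (models p u).card ≤ u * Real.log p := by
  rw [← Real.log_pow]
  exact Real.log_le_log (by exact_mod_cast (models_nonempty hu).card_pos) (card_models_le p u)

theorem toEuclideanLin_expWeightEstimator (M : Matrix ι (Fin p) ℝ) (y : EuclideanSpace ℝ ι)
    (α : ℝ) (u : ℕ) :
    M.toEuclideanLin (expWeightEstimator M y α u)
      = ∑ m ∈ models p u, expWeight M y α u m • (colSpan M m).starProjection y := by
  simp [expWeightEstimator, map_sum, toEuclideanLin_leastSquares]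

/-- The column span of `M` in the model `m`, extended by the signal `θ`. -/
noncomputable def extSpan (M : Matrix ι (Fin p) ℝ) (θ : EuclideanSpace ℝ ι) (m : Finset (Fin p)) :
    Submodule ℝ (EuclideanSpace ℝ ι) :=
  colSpan M m ⊔ Submodule.span ℝ {θ}

theorem finrank_extSpan_le (M : Matrix ι (Fin p) ℝ) (θ : EuclideanSpace ℝ ι)
    (m : Finset (Fin p)) : Module.finrank ℝ (extSpan M θ m) ≤ m.card + 1 :=
  (Submodule.finrank_add_le_finrank_add_finrank _ _).trans
    (add_le_add (finrank_colSpan_le M m) ((finrank_span_le_card _).trans (by simp)))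

theorem inner_le_norm_mul_norm_starProjection {E : Type*} [NormedAddCommGroup E]
    [InnerProductSpace ℝ E] (U : Submodule ℝ E) [U.HasOrthogonalProjection] {x : E} (hx : x ∈ U)
    (y : E) : |⟪x, y⟫| ≤ ‖x‖ * ‖U.starProjection y‖ := by
  have : ⟪x, y⟫ = ⟪x, U.starProjection y⟫ := by
    rw [← U.inner_starProjection_left_eq_right, U.starProjection_eq_self_iff.2 hx]
  rw [this]
  exact abs_real_inner_le_norm _ _

/-- Pathwise oracle inequality for the exponentially weighted estimator. -/
theorem norm_sub_expWeightEstimator_sq_le (M : Matrix ι (Fin p) ℝ) (θ ξ : EuclideanSpace ℝ ι)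
    {α : ℝ} (hα : 0 < α) {u : ℕ} (hu : u ≤ p) {m' : Finset (Fin p)} (hm' : m' ∈ models p u)
    {K : ℝ} (hK : ∀ m ∈ models p u, ‖(extSpan M θ m).starProjection ξ‖ ^ 2 ≤ K) :
    ‖θ - M.toEuclideanLin (expWeightEstimator M (θ + ξ) α u)‖ ^ 2
      ≤ 3 * ‖θ - (colSpan M m').starProjection θ‖ ^ 2 + 11 * K
        + 2 * α * (u * Real.log p) := by
  -- `R` is the squared bias, `N` the fitted noise and `C` the bias-noise cross term of a model.
  set w := expWeight M (θ + ξ) α u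
  set R : Finset (Fin p) → ℝ := fun m => ‖θ - (colSpan M m).starProjection θ‖ ^ 2
  set N : Finset (Fin p) → ℝ := fun m => ‖(colSpan M m).starProjection ξ‖ ^ 2
  set C : Finset (Fin p) → ℝ := fun m => ⟪θ - (colSpan M m).starProjection θ, ξ⟫
  have hw : ∀ m, 0 < w m := expWeight_pos M _ α hu
  have hw1 : ∑ m ∈ models p u, w m = 1 := sum_expWeight M _ α hu
  have hperp : ∀ m, ⟪θ - (colSpan M m).starProjection θ, (colSpan M m).starProjection ξ⟫ = 0 :=
    fun m => (colSpan M m).starProjection_inner_eq_zero _ _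
      ((colSpan M m).starProjection_apply_mem ξ)
  have hrss : ∀ m, ‖θ + ξ - (colSpan M m).starProjection (θ + ξ)‖ ^ 2
      = R m + 2 * C m + ‖ξ‖ ^ 2 - N m := fun m => by
    have h1 := norm_sub_sq_eq_starProjection (colSpan M m) ξ (colSpan M m).zero_mem
    have h2 : θ + ξ - (colSpan M m).starProjection (θ + ξ)
        = (θ - (colSpan M m).starProjection θ) + (ξ - (colSpan M m).starProjection ξ) := by
      rw [map_add]; abel
    rw [h2, norm_add_sq_real, inner_sub_right, hperp, sub_zero]
    simp only [sub_zero] at h1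
    simp only [R, C, N]
    linarith
  have hN : ∀ m ∈ models p u, N m ≤ K := fun m hm => by
    refine le_trans ?_ (hK m hm)
    have h1 : (colSpan M m).starProjection ξ
        = (colSpan M m).starProjection ((extSpan M θ m).starProjection ξ) := by
      have h2 := Submodule.starProjection_comp_starProjection_of_le
        (le_sup_left : colSpan M m ≤ extSpan M θ m)
      exact (DFunLike.congr_fun h2 ξ).symm
    simp only [N]
    rw [h1]
    gcongr
    exact Submodule.norm_starProjection_apply_le _ _
  -- The bias vector lies in the span of the columns and `θ`, which is why that span is enlarged by
  -- `θ`. Then `2ab ≤ a² / 2 + 2b²` leaves half of the bias to be absorbed.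
  have hC : ∀ m ∈ models p u, |2 * C m| ≤ R m / 2 + 2 * K := fun m hm => by
    have hmem : θ - (colSpan M m).starProjection θ ∈ extSpan M θ m :=
      Submodule.sub_mem _ (Submodule.mem_sup_right (Submodule.mem_span_singleton_self θ))
        (Submodule.mem_sup_left ((colSpan M m).starProjection_apply_mem θ))
    have h1 := inner_le_norm_mul_norm_starProjection _ hmem ξ
    have h2 := hK m hm
    rw [abs_mul, abs_two]
    simp only [R, C]
    nlinarith [sq_nonneg (‖θ - (colSpan M m).starProjection θ‖
      - 2 * ‖(extSpan M θ m).starProjection ξ‖)]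
  have hgibbs := sum_expWeight_mul_rss_le M (θ + ξ) hα hu hm'
  have h1 : ∑ m ∈ models p u, w m * (R m / 2 - 3 * K + ‖ξ‖ ^ 2)
      ≤ R m' + 2 * C m' + ‖ξ‖ ^ 2 - N m' + α * Real.log (models p u).card := by
    rw [← hrss]
    refine le_trans (Finset.sum_le_sum fun m hm => ?_) hgibbs
    rw [hrss]
    refine mul_le_mul_of_nonneg_left ?_ (hw m).le
    linarith [hN m hm, neg_abs_le (2 * C m), hC m hm]
  have h2 : ∑ m ∈ models p u, w m * (R m / 2 - 3 * K + ‖ξ‖ ^ 2)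
      = (∑ m ∈ models p u, w m * R m) / 2 + (- 3 * K + ‖ξ‖ ^ 2) := by
    calc _ = ∑ m ∈ models p u, (w m * R m / 2 + w m * (- 3 * K + ‖ξ‖ ^ 2)) :=
          Finset.sum_congr rfl fun m _ => by ring
      _ = _ := by
        rw [Finset.sum_add_distrib, ← Finset.sum_mul, hw1, one_mul, Finset.sum_div]
  have hNpos : 0 ≤ N m' := by positivity
  have h3 := mul_le_mul_of_nonneg_left (log_card_models_le hu) hα.le
  -- The left side keeps `R m / 2 - 3 K`, the right side is at most `(3/2) R m' + 2 K` plus the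
  -- entropy term; doubling gives `3` and `10`.
  have h4 : ∑ m ∈ models p u, w m * R m ≤ 3 * R m' + 10 * K + 2 * α * (u * Real.log p) := by
    linarith [le_abs_self (2 * C m'), hC m' hm']
  have h5 : θ - M.toEuclideanLin (expWeightEstimator M (θ + ξ) α u)
      = ∑ m ∈ models p u, w m • (θ - (colSpan M m).starProjection (θ + ξ)) := by
    simp_rw [smul_sub]
    rw [Finset.sum_sub_distrib, ← Finset.sum_smul, hw1, one_smul,
      toEuclideanLin_expWeightEstimator]
  have h6 : ∀ m, ‖θ - (colSpan M m).starProjection (θ + ξ)‖ ^ 2 = R m + N m := fun m => by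
    have : θ - (colSpan M m).starProjection (θ + ξ)
        = (θ - (colSpan M m).starProjection θ) - (colSpan M m).starProjection ξ := by
      rw [map_add]; abel
    rw [this, norm_sub_sq_real, hperp]
    simp only [R, N]
    ring
  -- Jensen's inequality: the error of the averaged fit is at most the averaged error. The fitted
  -- noise adds the eleventh `K`.
  have h7 : ‖θ - M.toEuclideanLin (expWeightEstimator M (θ + ξ) α u)‖ ^ 2
      ≤ ∑ m ∈ models p u, w m * (R m + N m) := by
    rw [h5]
    have hconv : ConvexOn ℝ Set.univ fun x : EuclideanSpace ℝ ι => ‖x‖ ^ 2 :=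
      (convexOn_norm convex_univ).pow (fun _ _ => norm_nonneg _) 2
    have := hconv.map_sum_le (t := models p u) (w := w)
      (p := fun m => θ - (colSpan M m).starProjection (θ + ξ))
      (fun m _ => (hw m).le) hw1 (fun _ _ => Set.mem_univ _)
    simpa only [h6, smul_eq_mul] using this
  have h8 : ∑ m ∈ models p u, w m * (R m + N m) ≤ ∑ m ∈ models p u, w m * R m + K := by
    calc _ ≤ ∑ m ∈ models p u, (w m * R m + w m * K) := by
          refine Finset.sum_le_sum fun m hm => ?_
          have := mul_le_mul_of_nonneg_left (hN m hm) (hw m).le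
          linarith
      _ = _ := by rw [Finset.sum_add_distrib, ← Finset.sum_mul, hw1, one_mul]
  linarith

end Oracle

/-! ### Measurability of the averaged fit. -/

section Measurability

variable {T : Type*} [MeasurableSpace T] {ι κ : Type*} [Fintype ι] [Fintype κ] {p : ℕ}

theorem measurable_euclidean_iff {f : T → EuclideanSpace ℝ ι} :
    Measurable f ↔ ∀ i, Measurable fun t => f t i := by
  refine ⟨fun h i => by fun_prop, fun h => ?_⟩
  exact (WithLp.measurable_toLp 2 (ι → ℝ)).comp (measurable_pi_iff.2 h)

theorem measurable_toEuclideanLin_apply [DecidableEq κ] {M : T → Matrix ι κ ℝ}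
    {b : T → EuclideanSpace ℝ κ}
    (hM : ∀ i j, Measurable fun t => M t i j) (hb : Measurable b) :
    Measurable fun t => (M t).toEuclideanLin (b t) := by
  refine measurable_euclidean_iff.2 fun i => ?_
  simp only [Matrix.toLpLin_apply, Matrix.mulVec, dotProduct]
  exact Finset.measurable_sum _ fun j _ => (hM i j).mul (measurable_euclidean_iff.1 hb j)

/-- The coefficient vector that agrees with `b` on the model `m` and vanishes elsewhere. -/
noncomputable def restrictTo (m : Finset (Fin p)) (b : Fin p → ℝ) : EuclideanSpace ℝ (Fin p) :=
  WithLp.toLp 2 fun j => if j ∈ m then b j else 0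

/-- By density, coefficients may be taken rational, so sublevel sets of the distance to the column
span are countable unions. No measurable choice of least-squares coefficients is needed. -/
theorem norm_sub_starProjection_colSpan_lt_iff (M : Matrix ι (Fin p) ℝ) (m : Finset (Fin p))
    (y : EuclideanSpace ℝ ι) (a : ℝ) :
    ‖y - (colSpan M m).starProjection y‖ < a ↔
      ∃ b : Fin p → ℚ, ‖y - M.toEuclideanLin (restrictTo m fun j => (b j : ℝ))‖ < a := by
  constructor
  · intro h
    obtain ⟨b, hb, hb'⟩ := (mem_colSpan_iff M m _).1 ((colSpan M m).starProjection_apply_mem y)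
    have hcont : Continuous fun b : Fin p → ℝ => ‖y - M.toEuclideanLin (restrictTo m b)‖ := by
      have h1 : Continuous fun b : Fin p → ℝ => restrictTo m b := by
        refine (PiLp.continuous_toLp 2 _).comp (continuous_pi fun j => ?_)
        split_ifs <;> fun_prop
      have h2 := LinearMap.continuous_of_finiteDimensional M.toEuclideanLin
      fun_prop
    have hbm : restrictTo m b = b := by
      ext j
      by_cases hj : j ∈ m
      · simp [restrictTo, hj]
      · simp [restrictTo, hj, hb j hj]
    have hdense : DenseRange fun (b : Fin p → ℚ) (j : Fin p) => (b j : ℝ) :=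
      DenseRange.piMap fun _ => Rat.denseRange_cast
    obtain ⟨c, hc⟩ := hdense.exists_mem_open (isOpen_Iio.preimage hcont)
      ⟨b.ofLp, show ‖y - M.toEuclideanLin (restrictTo m b)‖ < a by rwa [hbm, hb']⟩
    exact ⟨c, hc⟩
  · rintro ⟨b, hb⟩
    refine (norm_sub_starProjection_le _ y ((mem_colSpan_iff M m _).2 ⟨_, ?_, rfl⟩)).trans_lt hb
    intro j hj
    simp [restrictTo, hj]

variable {M : T → Matrix ι (Fin p) ℝ} {y : T → EuclideanSpace ℝ ι}

theorem measurable_norm_sub_starProjection_colSpan (hM : ∀ i j, Measurable fun t => M t i j)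
    (hy : Measurable y) (m : Finset (Fin p)) :
    Measurable fun t => ‖y t - (colSpan (M t) m).starProjection (y t)‖ := by
  refine measurable_of_Iio fun a => ?_
  have : (fun t => ‖y t - (colSpan (M t) m).starProjection (y t)‖) ⁻¹' Set.Iio a
      = ⋃ b : Fin p → ℚ, {t | ‖y t - (M t).toEuclideanLin
        (restrictTo m fun j => (b j : ℝ))‖ < a} := by
    ext t
    simpa using norm_sub_starProjection_colSpan_lt_iff (M t) m (y t) a
  rw [this]
  exact MeasurableSet.iUnion fun b => measurableSet_lt
    (hy.sub (measurable_toEuclideanLin_apply hM measurable_const)).norm measurable_const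

theorem measurable_starProjection_colSpan (hM : ∀ i j, Measurable fun t => M t i j)
    (hy : Measurable y) (m : Finset (Fin p)) :
    Measurable fun t => (colSpan (M t) m).starProjection (y t) := by
  classical
  have hq : ∀ z : T → EuclideanSpace ℝ ι, Measurable z →
      Measurable fun t => ‖(colSpan (M t) m).starProjection (z t)‖ ^ 2 := fun z hz => by
    have h : ∀ t, ‖(colSpan (M t) m).starProjection (z t)‖ ^ 2
        = ‖z t‖ ^ 2 - ‖z t - (colSpan (M t) m).starProjection (z t)‖ ^ 2 := fun t => by
      have := norm_sub_sq_eq_starProjection (colSpan (M t) m) (z t) (colSpan (M t) m).zero_mem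
      simp only [sub_zero] at this
      linarith
    simp_rw [h]
    exact (hz.norm.pow_const 2).sub
      ((measurable_norm_sub_starProjection_colSpan hM hz m).pow_const 2)
  refine measurable_euclidean_iff.2 fun i => ?_
  let e : EuclideanSpace ℝ ι := EuclideanSpace.single i 1
  -- Polarisation recovers each coordinate of the projection from squared norms, which Pythagoras
  -- expresses by distances.
  have h : ∀ t, (colSpan (M t) m).starProjection (y t) i
      = (‖(colSpan (M t) m).starProjection (y t + e)‖ ^ 2
        - ‖(colSpan (M t) m).starProjection (y t - e)‖ ^ 2) / 4 := fun t => by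
    have h1 : ⟪(colSpan (M t) m).starProjection (y t), (colSpan (M t) m).starProjection e⟫
        = (colSpan (M t) m).starProjection (y t) i := by
      rw [← Submodule.inner_starProjection_left_eq_right,
        Submodule.starProjection_eq_self_iff.2 (Submodule.starProjection_apply_mem _ _)]
      simp [e, EuclideanSpace.inner_single_right]
    rw [map_add, map_sub, norm_add_sq_real, norm_sub_sq_real, h1]
    ring
  simp_rw [h]
  exact ((hq _ (hy.add_const e)).sub (hq _ (hy.sub_const e))).div_const 4

theorem measurable_toEuclideanLin_expWeightEstimator (hM : ∀ i j, Measurable fun t => M t i j)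
    (hy : Measurable y) {α : T → ℝ} (hα : Measurable α) (u : ℕ) :
    Measurable fun t => (M t).toEuclideanLin (expWeightEstimator (M t) (y t) (α t) u) := by
  have hraw : ∀ m, Measurable fun t => rawWeight (M t) (y t) (α t) m := fun m => by
    simp only [rawWeight, toEuclideanLin_leastSquares]
    exact (((hα.const_div 1).neg).mul
      ((measurable_norm_sub_starProjection_colSpan hM hy m).pow_const 2)).exp
  simp only [toEuclideanLin_expWeightEstimator, expWeight]
  exact Finset.measurable_sum _ fun m _ =>
    ((hraw m).div (Finset.measurable_sum _ fun k _ => hraw k)).smul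
      (measurable_starProjection_colSpan hM hy m)

end Measurability

/-! ### The estimators as measurable functions of the stacked residual. -/

namespace Design

variable {n p v r na nb : ℕ}

/-- The residual vector of the averaged fit in the stacked reduced model. -/
noncomputable def residual (D : Design n p v r na nb) (u : ℕ) (Y : EuclideanSpace ℝ (Fin n)) :
    EuclideanSpace ℝ (Fin na ⊕ Fin nb) :=
  D.Q.toEuclideanLin Y - (D.Q * D.X).toEuclideanLin (D.betaHat u Y)

/-- The first block of a stacked vector. -/
def fstBlock (x : EuclideanSpace ℝ (Fin na ⊕ Fin nb)) : EuclideanSpace ℝ (Fin na) :=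
  WithLp.toLp 2 fun i => x (Sum.inl i)

/-- The second block of a stacked vector. -/
def sndBlock (x : EuclideanSpace ℝ (Fin na ⊕ Fin nb)) : EuclideanSpace ℝ (Fin nb) :=
  WithLp.toLp 2 fun i => x (Sum.inr i)

theorem norm_sq_eq_blocks (x : EuclideanSpace ℝ (Fin na ⊕ Fin nb)) :
    ‖x‖ ^ 2 = ‖fstBlock x‖ ^ 2 + ‖sndBlock x‖ ^ 2 := by
  simp [EuclideanSpace.real_norm_sq_eq, fstBlock, sndBlock]

theorem fstBlock_Q (D : Design n p v r na nb) (x : EuclideanSpace ℝ (Fin n)) :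
    fstBlock (D.Q.toEuclideanLin x) = D.A.toEuclideanLin x := by
  ext i
  simp [fstBlock, Q, Matrix.toLpLin_apply, Matrix.mulVec, dotProduct]

theorem sndBlock_Q (D : Design n p v r na nb) (x : EuclideanSpace ℝ (Fin n)) :
    sndBlock (D.Q.toEuclideanLin x) = D.B.toEuclideanLin x := by
  ext i
  simp [sndBlock, Q, Matrix.toLpLin_apply, Matrix.mulVec, dotProduct]

theorem residual_eq (D : Design n p v r na nb) (u : ℕ) (Y : EuclideanSpace ℝ (Fin n)) :
    D.residual u Y = D.Q.toEuclideanLin (Y - D.X.toEuclideanLin (D.betaHat u Y)) := by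
  rw [residual, toEuclideanLin_mul_apply, map_sub]

/-- The estimated coefficients enter only through the fitted vector `Q X β̂`, which unlike `β̂` does
not depend on the choice of minimisers. -/
theorem sigmaEpsSqHat_eq (D : Design n p v r na nb) (u : ℕ) (Y : EuclideanSpace ℝ (Fin n)) :
    D.sigmaEpsSqHat u Y = 1 / (nb : ℝ) * ‖sndBlock (D.residual u Y)‖ ^ 2 := by
  rw [sigmaEpsSqHat, residual_eq, sndBlock_Q, map_sub, toEuclideanLin_mul_apply]

theorem sigmaNuSqHat_eq (D : Design n p v r na nb) (u : ℕ) (Y : EuclideanSpace ℝ (Fin n)) :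
    D.sigmaNuSqHat u Y = 1 / D.Dinv.trace *
      ‖D.whiten.toEuclideanLin (fstBlock (D.residual u Y))‖ ^ 2 - D.sigmaEpsSqHat u Y := by
  rw [sigmaNuSqHat, residual_eq, fstBlock_Q, map_sub, map_sub, toEuclideanLin_mul_apply,
    toEuclideanLin_mul_apply, toEuclideanLin_mul_apply]

section Measurability

theorem measurable_toTuple :
    Measurable (toTuple : Design n p v r na nb → _) := comap_measurable _

theorem measurable_X (i : Fin n) (j : Fin p) :
    Measurable fun D : Design n p v r na nb => D.X i j :=
  ((measurable_pi_apply j).comp (measurable_pi_apply i)).comp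
    (measurable_fst.comp measurable_toTuple)

theorem measurable_Z (i : Fin n) (j : Fin v) :
    Measurable fun D : Design n p v r na nb => D.Z i j :=
  ((measurable_pi_apply j).comp (measurable_pi_apply i)).comp
    (measurable_fst.comp (measurable_snd.comp measurable_toTuple))

theorem measurable_μ : Measurable fun D : Design n p v r na nb => D.μ :=
  measurable_euclidean_iff.2 fun i => (measurable_pi_apply i).comp
    (measurable_fst.comp (measurable_snd.comp (measurable_snd.comp
      (measurable_snd.comp measurable_toTuple))))

theorem measurable_A (i : Fin na) (j : Fin n) :
    Measurable fun D : Design n p v r na nb => D.A i j :=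
  ((measurable_pi_apply j).comp (measurable_pi_apply i)).comp
    (measurable_fst.comp (measurable_snd.comp (measurable_snd.comp (measurable_snd.comp
      (measurable_snd.comp measurable_toTuple)))))

theorem measurable_B (i : Fin nb) (j : Fin n) :
    Measurable fun D : Design n p v r na nb => D.B i j :=
  ((measurable_pi_apply j).comp (measurable_pi_apply i)).comp
    (measurable_fst.comp (measurable_snd.comp (measurable_snd.comp (measurable_snd.comp
      (measurable_snd.comp (measurable_snd.comp measurable_toTuple))))))

theorem measurable_V (i j : Fin na) :
    Measurable fun D : Design n p v r na nb => D.V i j :=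
  ((measurable_pi_apply j).comp (measurable_pi_apply i)).comp
    (measurable_fst.comp (measurable_snd.comp (measurable_snd.comp (measurable_snd.comp
      (measurable_snd.comp (measurable_snd.comp (measurable_snd.comp measurable_toTuple)))))))

theorem measurable_d (i : Fin na) : Measurable fun D : Design n p v r na nb => D.d i :=
  (measurable_pi_apply i).comp
    (measurable_fst.comp (measurable_snd.comp (measurable_snd.comp (measurable_snd.comp
      (measurable_snd.comp (measurable_snd.comp (measurable_snd.comp
        (measurable_snd.comp measurable_toTuple))))))))

theorem measurable_α : Measurable fun D : Design n p v r na nb => D.α :=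
  measurable_snd.comp (measurable_snd.comp (measurable_snd.comp (measurable_snd.comp
      (measurable_snd.comp (measurable_snd.comp (measurable_snd.comp
        (measurable_snd.comp measurable_toTuple)))))))

theorem measurable_Q (i : Fin na ⊕ Fin nb) (j : Fin n) :
    Measurable fun D : Design n p v r na nb => D.Q i j := by
  cases i with
  | inl i => exact measurable_A i j
  | inr i => exact measurable_B i j

theorem measurable_trace_Dinv : Measurable fun D : Design n p v r na nb => D.Dinv.trace := by
  simp only [Dinv, Matrix.trace_diagonal]
  exact Finset.measurable_sum _ fun i _ => (measurable_d i).inv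

theorem measurable_dHat : Measurable fun D : Design n p v r na nb => D.dHat :=
  measurable_trace_Dinv.const_div _

theorem measurable_whiten (i j : Fin na) :
    Measurable fun D : Design n p v r na nb => D.whiten i j := by
  simp only [whiten, Matrix.diagonal_mul, Matrix.transpose_apply]
  exact (measurable_d i).sqrt.inv.mul (measurable_V j i)

variable {T : Type*} [MeasurableSpace T] {D : T → Design n p v r na nb}
  {Y : T → EuclideanSpace ℝ (Fin n)}

theorem measurable_residual (hD : Measurable D) (hY : Measurable Y) (u : ℕ) :
    Measurable fun t => (D t).residual u (Y t) := by
  have hQ : ∀ i j, Measurable fun t => (D t).Q i j := fun i j => (measurable_Q i j).comp hD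
  have hQY := measurable_toEuclideanLin_apply hQ hY
  refine hQY.sub (measurable_toEuclideanLin_expWeightEstimator (fun i j => ?_) hQY
    (measurable_α.comp hD) u)
  simp only [Matrix.mul_apply]
  exact Finset.measurable_sum _ fun k _ => (hQ i k).mul ((measurable_X k j).comp hD)

theorem measurable_sigmaEpsSqHat (hD : Measurable D) (hY : Measurable Y) (u : ℕ) :
    Measurable fun t => (D t).sigmaEpsSqHat u (Y t) := by
  simp only [sigmaEpsSqHat_eq]
  refine ((Measurable.norm ?_).pow_const 2).const_mul _
  exact measurable_euclidean_iff.2 fun i =>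
    measurable_euclidean_iff.1 (measurable_residual hD hY u) (Sum.inr i)

theorem measurable_sigmaNuSqHat (hD : Measurable D) (hY : Measurable Y) (u : ℕ) :
    Measurable fun t => (D t).sigmaNuSqHat u (Y t) := by
  simp only [sigmaNuSqHat_eq]
  refine (((measurable_trace_Dinv.comp hD).const_div 1).mul ((Measurable.norm ?_).pow_const 2)).sub
    (measurable_sigmaEpsSqHat hD hY u)
  refine measurable_toEuclideanLin_apply (fun i j => (measurable_whiten i j).comp hD) ?_
  exact measurable_euclidean_iff.2 fun i =>
    measurable_euclidean_iff.1 (measurable_residual hD hY u) (Sum.inl i)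

theorem measurable_sigmaASqHat (hD : Measurable D) (hY : Measurable Y) (u : ℕ) :
    Measurable fun t => (D t).sigmaASqHat u (Y t) := by
  simp only [sigmaASqHat]
  refine ((Finset.measurable_sum _ fun k _ => ?_).const_mul _).div
    ((measurable_trace_Dinv.comp hD).pow_const 2)
  exact (((measurable_sigmaNuSqHat hD hY u).div (measurable_dHat.comp hD)).add
    (((measurable_d k).comp hD).inv.mul (measurable_sigmaEpsSqHat hD hY u))).pow_const 2

theorem measurable_sigmaBSqHat (hD : Measurable D) (hY : Measurable Y) (u : ℕ) :
    Measurable fun t => (D t).sigmaBSqHat u (Y t) := by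
  simp only [sigmaBSqHat]
  exact (((measurable_sigmaEpsSqHat hD hY u).pow_const 2).const_mul _).div_const _

theorem measurable_response {ν : T → EuclideanSpace ℝ (Fin v)} {ε : T → EuclideanSpace ℝ (Fin n)}
    (hD : Measurable D) (hν : Measurable ν) (hε : Measurable ε) :
    Measurable fun t => (D t).response (ν t) 0 (ε t) := by
  simp only [response, map_zero, add_zero]
  exact ((measurable_μ.comp hD).add (measurable_toEuclideanLin_apply
    (fun i j => (measurable_Z i j).comp hD) hν)).add hε

end Measurability

end Design

/-! ### Norm bounds for matrices with orthonormal rows. -/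

section Norms

variable {ι κ : Type*} [Fintype ι] [Fintype κ] [DecidableEq ι] [DecidableEq κ]

theorem norm_transpose_toEuclideanLin {M : Matrix κ ι ℝ} (hM : M * M.transpose = 1)
    (x : EuclideanSpace ℝ κ) : ‖M.transpose.toEuclideanLin x‖ = ‖x‖ := by
  rw [← sq_eq_sq₀ (norm_nonneg _) (norm_nonneg _), ← real_inner_self_eq_norm_sq,
    ← real_inner_self_eq_norm_sq, inner_toEuclideanLin_left, Matrix.transpose_transpose,
    ← toEuclideanLin_mul_apply, hM]
  simp

theorem norm_toEuclideanLin_le {M : Matrix κ ι ℝ} (hM : M * M.transpose = 1)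
    (x : EuclideanSpace ℝ ι) : ‖M.toEuclideanLin x‖ ≤ ‖x‖ := by
  have h : ‖M.toEuclideanLin x‖ ^ 2 ≤ ‖x‖ * ‖M.toEuclideanLin x‖ := by
    rw [← real_inner_self_eq_norm_sq, inner_toEuclideanLin_left]
    refine (real_inner_le_norm _ _).trans (le_of_eq ?_)
    rw [norm_transpose_toEuclideanLin hM]
  nlinarith [norm_nonneg (M.toEuclideanLin x), norm_nonneg x]

/-- The image under `M` of the best approximation in `S` is a competitor in the larger model, and
`M` is a contraction. Weak sparsity of `μ` thus passes to `Q μ`. -/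
theorem norm_sub_starProjection_colSpan_mul_le {p : ℕ} {M : Matrix κ ι ℝ}
    (hM : M * M.transpose = 1) (X : Matrix ι (Fin p) ℝ) {S m : Finset (Fin p)} (hS : S ⊆ m)
    (x : EuclideanSpace ℝ ι) :
    ‖M.toEuclideanLin x - (colSpan (M * X) m).starProjection (M.toEuclideanLin x)‖
      ≤ ‖(colSpan X S)ᗮ.starProjection x‖ := by
  obtain ⟨b, hb, hb'⟩ := (mem_colSpan_iff X S _).1 ((colSpan X S).starProjection_apply_mem x)
  have hmem : M.toEuclideanLin ((colSpan X S).starProjection x) ∈ colSpan (M * X) m :=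
    (mem_colSpan_iff _ _ _).2 ⟨b, fun j hj => hb j fun h => hj (hS h), by
      rw [toEuclideanLin_mul_apply, hb']⟩
  refine (norm_sub_starProjection_le _ _ hmem).trans ?_
  rw [← map_sub, Submodule.starProjection_orthogonal_val]
  exact norm_toEuclideanLin_le hM _

end Norms

/-! ### Whitening and the fit error in the reduced model. -/

namespace Design

variable {n p v r na nb : ℕ} {D : Design n p v r na nb}

theorem IsReduction.Q_mul_transpose (h : D.IsReduction) : D.Q * D.Q.transpose = 1 := by
  have h2 : D.B * D.A.transpose = 0 := by
    have := congrArg Matrix.transpose h.orthogonal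
    simpa using this
  rw [Q, Matrix.transpose_fromRows, Matrix.fromRows_mul_fromCols, h.orthonormal_A, h.orthogonal,
    h2, h.orthonormal_B, Matrix.fromBlocks_one]

theorem IsReduction.Q_mul_W (h : D.IsReduction) : D.Q * D.W = 0 := by
  rw [Q, Matrix.fromRows_mul, h.A_W, h.B_W]
  simp

theorem inv_d_le {σν2 σε2 : ℝ} (hσν : 0 ≤ σν2) (hσε : 0 < σε2) (k : Fin na) :
    (D.d k)⁻¹ ≤ ‖D.noiseVar σν2 σε2‖ / σε2 := by
  rw [le_div_iff₀ hσε]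
  have h1 := norm_le_pi_norm (D.noiseVar σν2 σε2) k
  have h2 := (le_abs_self _).trans h1
  simp only [noiseVar] at h2 ⊢
  linarith

theorem norm_whiten_sq_le (h : D.IsReduction) {σν2 σε2 : ℝ} (hσν : 0 ≤ σν2) (hσε : 0 < σε2)
    (x : EuclideanSpace ℝ (Fin na)) :
    ‖D.whiten.toEuclideanLin x‖ ^ 2 ≤ ‖D.noiseVar σν2 σε2‖ / σε2 * ‖x‖ ^ 2 := by
  have hV := norm_transpose_toEuclideanLin ((Matrix.mem_orthogonalGroup_iff _ _).1 h.V_orthogonal) x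
  rw [whiten, toEuclideanLin_mul_apply, ← hV, EuclideanSpace.real_norm_sq_eq,
    EuclideanSpace.real_norm_sq_eq, Finset.mul_sum]
  refine Finset.sum_le_sum fun k _ => ?_
  rw [Matrix.toLpLin_apply]
  simp only [Matrix.mulVec_diagonal, mul_pow, inv_pow]
  rw [Real.sq_sqrt (h.d_pos k).le]
  exact mul_le_mul_of_nonneg_right (inv_d_le hσν hσε k) (sq_nonneg _)

/-- The error of the averaged fit for the stacked mean vector. -/
noncomputable def fitError (D : Design n p v r na nb) (u : ℕ) (Y : EuclideanSpace ℝ (Fin n)) :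
    EuclideanSpace ℝ (Fin na ⊕ Fin nb) :=
  D.Q.toEuclideanLin D.μ - (D.Q * D.X).toEuclideanLin (D.betaHat u Y)

theorem residual_eq_fitError (u : ℕ) (ξ : EuclideanSpace ℝ (Fin n)) :
    D.residual u (D.μ + ξ) = D.fitError u (D.μ + ξ) + D.Q.toEuclideanLin ξ := by
  rw [residual, fitError, map_add]
  abel

theorem norm_fitError_sq_le (h : D.IsReduction) (hα : 0 < D.α) {u : ℕ} (hu : u ≤ p)
    {S : Finset (Fin p)} (hS : S.card ≤ u) (ξ : EuclideanSpace ℝ (Fin n)) {K : ℝ}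
    (hK : ∀ m ∈ models p u, ‖(extSpan (D.Q * D.X) (D.Q.toEuclideanLin D.μ) m).starProjection
      (D.Q.toEuclideanLin ξ)‖ ^ 2 ≤ K) :
    ‖D.fitError u (D.μ + ξ)‖ ^ 2 ≤ 3 * ‖(colSpan D.X S)ᗮ.starProjection D.μ‖ ^ 2 + 11 * K
      + 2 * D.α * (u * Real.log p) := by
  -- The sparse model is padded to exactly `u` columns, as only such models are averaged.
  obtain ⟨m, hSm, -, hm⟩ := Finset.exists_subsuperset_card_eq (Finset.subset_univ S) hS
    (by simpa using hu)
  have hm' : m ∈ models p u := Finset.mem_powersetCard.2 ⟨Finset.subset_univ _, hm⟩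
  have h1 := norm_sub_expWeightEstimator_sq_le (D.Q * D.X) (D.Q.toEuclideanLin D.μ)
    (D.Q.toEuclideanLin ξ) hα hu hm' hK
  have h2 := norm_sub_starProjection_colSpan_mul_le h.Q_mul_transpose D.X hSm D.μ
  rw [fitError, betaHat, map_add]
  refine h1.trans ?_
  gcongr

end Design

/-! ### Deterministic rates from the design conditions. -/

section Limits

variable {l : Filter ℕ}

/-- After taking square roots, `√c z` and `√c x` differ by at most `√c y`, which vanishes. This
transfers limits of scaled squared norms from the noise to the residual. -/
theorem tendsto_mul_sq_of_abs_sub_le {c x y z : ℕ → ℝ} {A : ℝ} (hc : ∀ᶠ n in l, 0 ≤ c n)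
    (hx : ∀ n, 0 ≤ x n) (hy : ∀ n, 0 ≤ y n) (h : ∀ n, |z n - x n| ≤ y n)
    (hA : Tendsto (fun n => c n * x n ^ 2) l (𝓝 A))
    (h0 : Tendsto (fun n => c n * y n ^ 2) l (𝓝 0)) :
    Tendsto (fun n => c n * z n ^ 2) l (𝓝 A) := by
  have hsq : ∀ w : ℕ → ℝ, (∀ n, 0 ≤ w n) → ∀ᶠ n in l, √(c n * w n ^ 2) = √(c n) * w n :=
    fun w hw => by
      filter_upwards [hc] with n hn
      rw [Real.sqrt_mul hn, Real.sqrt_sq (hw n)]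
  have h1 := (hA.sqrt).congr' (hsq x hx)
  have h2 := (h0.sqrt).congr' (hsq y hy)
  rw [Real.sqrt_zero] at h2
  have h3 : Tendsto (fun n => √(c n) * z n - √(c n) * x n) l (𝓝 0) := by
    refine squeeze_zero_norm (fun n => ?_) h2
    rw [← mul_sub, Real.norm_eq_abs, abs_mul, abs_of_nonneg (Real.sqrt_nonneg _)]
    exact mul_le_mul_of_nonneg_left (h n) (Real.sqrt_nonneg _)
  have h4 := (h3.add h1).pow 2
  simp only [sub_add_cancel, zero_add] at h4
  rcases l.eq_or_neBot with rfl | hl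
  · exact tendsto_bot
  have hA0 : 0 ≤ A := ge_of_tendsto hA (hc.mono fun n hn => by positivity)
  rw [Real.sq_sqrt hA0] at h4
  refine h4.congr' ?_
  filter_upwards [hc] with n hn
  rw [mul_pow, Real.sq_sqrt hn]

theorem tendsto_zero_of_isBigO_one {f g : ℕ → ℝ} (hf : f =O[l] fun _ => (1 : ℝ))
    (hg : Tendsto g l (𝓝 0)) : Tendsto (fun n => f n * g n) l (𝓝 0) := by
  have := hf.mul_isLittleO ((isLittleO_one_iff ℝ).2 hg)
  simpa using (this.trans_isBigO (isBigO_refl _ _))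

variable {p v r na nb s u : ℕ → ℕ} {σν2 σε2 σa2 σb2 dbar : ℝ}
  {D : ∀ n, Design n (p n) (v n) (r n) (na n) (nb n)}

theorem isBigO_natCast_div_of_isTheta {m : ℕ → ℕ}
    (hm : (fun n => (m n : ℝ)) =Θ[atTop] fun n : ℕ => (n : ℝ)) :
    (fun n : ℕ => (n : ℝ) / m n) =O[atTop] fun _ => (1 : ℝ) := by
  have h1 : (fun n : ℕ => (n : ℝ) * (m n : ℝ)⁻¹) =O[atTop] fun n => (m n : ℝ) * (m n : ℝ)⁻¹ :=
    hm.2.mul (isBigO_refl _ _)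
  refine h1.trans (IsBigO.of_bound 1 (Eventually.of_forall fun n => ?_))
  rw [norm_one, mul_one, Real.norm_of_nonneg (by positivity)]
  exact mul_inv_le_one

theorem DesignConditions.trace_eventually_pos (h : DesignConditions D s σν2 σε2 σa2 dbar)
    (hdbar : 0 < dbar) : ∀ᶠ n in atTop, 0 < (D n).Dinv.trace := by
  filter_upwards [h.tendsto_dbar.eventually (lt_mem_nhds hdbar)] with n hn
  by_contra hcon
  exact absurd hn (not_lt.2 (div_nonpos_of_nonneg_of_nonpos (by positivity) (not_lt.1 hcon)))

theorem DesignConditions.isBigO_div_trace (h : DesignConditions D s σν2 σε2 σa2 dbar)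
    (hna : (fun n => (na n : ℝ)) =Θ[atTop] fun n : ℕ => (n : ℝ)) :
    (fun n : ℕ => (n : ℝ) / (D n).Dinv.trace) =O[atTop] fun _ => (1 : ℝ) := by
  have h1 := h.tendsto_dbar.isBigO_one ℝ
  refine IsBigO.trans ?_ h1
  exact hna.2.mul (isBigO_refl (fun n => ((D n).Dinv.trace)⁻¹) _)

theorem DesignConditions.isBigO_trace (h : DesignConditions D s σν2 σε2 σa2 dbar)
    (hdbar : 0 < dbar) (hna : (fun n => (na n : ℝ)) =Θ[atTop] fun n : ℕ => (n : ℝ)) :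
    (fun n : ℕ => (D n).Dinv.trace) =O[atTop] fun n : ℕ => (n : ℝ) := by
  refine IsBigO.trans (IsBigO.of_bound (2 / dbar) ?_) hna.1
  filter_upwards [h.trace_eventually_pos hdbar,
    h.tendsto_dbar.eventually (lt_mem_nhds (half_lt_self hdbar))] with n h1 h2
  rw [lt_div_iff₀ h1] at h2
  rw [Real.norm_of_nonneg h1.le, Real.norm_of_nonneg (by positivity), div_mul_eq_mul_div,
    le_div_iff₀ hdbar]
  linarith

/-- The limit of `2 n ‖ω‖₂² / (Tr D⁻¹)²` and `Tr D⁻¹ = O(n)` give `‖ω‖₂² = O(n)`. -/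
theorem DesignConditions.isBigO_noiseVar (h : DesignConditions D s σν2 σε2 σa2 dbar)
    (hdbar : 0 < dbar) (hna : (fun n => (na n : ℝ)) =Θ[atTop] fun n : ℕ => (n : ℝ)) :
    (fun n : ℕ => ‖WithLp.toLp 2 ((D n).noiseVar σν2 σε2)‖ / √n) =O[atTop] fun _ => (1 : ℝ) := by
  refine IsBigO.of_pow (n := 2) two_ne_zero ?_
  have h1 := (h.tendsto_σa2.isBigO_one ℝ).mul ((h.isBigO_trace hdbar hna).pow 2)
  have h2 := h1.mul (isBigO_refl (fun n : ℕ => ((n : ℝ) ^ 2)⁻¹) atTop)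
  refine (h2.const_mul_left (1 / 2)).congr' ?_ ?_
  · filter_upwards [h.trace_eventually_pos hdbar, eventually_gt_atTop 0] with n hn hn0
    have hn0' : (0 : ℝ) < n := by exact_mod_cast hn0
    rw [Pi.pow_apply, div_pow, Real.sq_sqrt hn0'.le]
    field_simp
  · filter_upwards [eventually_gt_atTop 0] with n hn0
    have hn0' : (0 : ℝ) < n := by exact_mod_cast hn0
    simp [hn0'.ne']

theorem DesignConditions.tendsto_norm_noiseVar_div (h : DesignConditions D s σν2 σε2 σa2 dbar)
    (hσa : 0 < σa2)
    (hdbar : 0 < dbar) (hna : (fun n => (na n : ℝ)) =Θ[atTop] fun n : ℕ => (n : ℝ)) :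
    Tendsto (fun n : ℕ => ‖(D n).noiseVar σν2 σε2‖ / √n) atTop (𝓝 0) := by
  refine (tendsto_zero_of_isBigO_one (h.isBigO_noiseVar hdbar hna) h.balanced).congr' ?_
  -- Positivity of `σa2` excludes a zero Euclidean norm, so the two ratios can be multiplied and the
  -- norm cancelled.
  have hne : ∀ᶠ n in atTop, ‖WithLp.toLp 2 ((D n).noiseVar σν2 σε2)‖ ≠ 0 := by
    filter_upwards [h.tendsto_σa2.eventually_ne hσa.ne'] with n hn h0
    simp [h0] at hn
  filter_upwards [hne] with n hn
  field_simp

/-- The error of the averaged fit is of smaller order than `√n` in squared norm. -/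
theorem DesignConditions.tendsto_norm_fitError (h : DesignConditions D s σν2 σε2 σa2 dbar)
    (hl : l ≤ atTop) (hu_le : ∀ n, u n ≤ p n) (hus : ∀ᶠ n in atTop, s n ≤ u n)
    (hulog : Tendsto (fun n : ℕ => (u n : ℝ) * Real.log (p n) / √n) atTop (𝓝 0))
    (ξ : ∀ n, EuclideanSpace ℝ (Fin n)) {K : ℕ → ℝ}
    (hK : ∀ n, ∀ m ∈ models (p n) (u n), ‖(extSpan ((D n).Q * (D n).X)
      ((D n).Q.toEuclideanLin (D n).μ) m).starProjection ((D n).Q.toEuclideanLin (ξ n))‖ ^ 2 ≤ K n)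
    (hK0 : Tendsto (fun n : ℕ => K n / √n) l (𝓝 0)) :
    Tendsto (fun n : ℕ => ‖(D n).fitError (u n) ((D n).μ + ξ n)‖ ^ 2 / √n) l (𝓝 0) := by
  obtain ⟨S, hS, hSo⟩ := h.weaklySparse
  have h1 : Tendsto (fun n : ℕ => ‖(colSpan (D n).X (S n))ᗮ.starProjection (D n).μ‖ ^ 2 / √n)
      l (𝓝 0) := hSo.tendsto_div_nhds_zero.mono_left hl
  have h2 := (tendsto_zero_of_isBigO_one h.α_bounded hulog).mono_left hl
  have h3 := ((h1.const_mul 3).add (hK0.const_mul 11)).add (h2.const_mul 2)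
  simp only [mul_zero, add_zero] at h3
  refine squeeze_zero' (Eventually.of_forall fun n => by positivity) ?_ h3
  filter_upwards [hl hus] with n hn
  have hc : (S n).card ≤ u n := (Finset.mem_powersetCard.1 (hS n)).2.trans_le hn
  have h4 := (D n).norm_fitError_sq_le (h.reduction n) (h.α_pos n) (hu_le n) hc (ξ n) (hK n)
  refine (div_le_div_of_nonneg_right h4 (Real.sqrt_nonneg _)).trans (le_of_eq ?_)
  ring

end Limits

/-! ### Deterministic convergence of the estimators along a filter. -/

section Limits

variable {l : Filter ℕ}

variable {p v r na nb s u : ℕ → ℕ} {σν2 σε2 σa2 σb2 dbar : ℝ}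
  {D : ∀ n, Design n (p n) (v n) (r n) (na n) (nb n)}

theorem DesignConditions.tendsto_sigmaEpsSqHat
    (hnb : (fun n => (nb n : ℝ)) =Θ[atTop] fun n : ℕ => (n : ℝ)) (hl : l ≤ atTop)
    (ξ : ∀ n, EuclideanSpace ℝ (Fin n))
    (he : Tendsto (fun n : ℕ => ‖(D n).fitError (u n) ((D n).μ + ξ n)‖ ^ 2 / √n) l (𝓝 0))
    (ha : Tendsto (fun n : ℕ => 1 / (nb n : ℝ) * ‖(D n).B.toEuclideanLin (ξ n)‖ ^ 2) l (𝓝 σε2)) :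
    Tendsto (fun n => (D n).sigmaEpsSqHat (u n) ((D n).μ + ξ n)) l (𝓝 σε2) := by
  simp only [Design.sigmaEpsSqHat_eq]
  refine tendsto_mul_sq_of_abs_sub_le
    (y := fun n => ‖(D n).fitError (u n) ((D n).μ + ξ n)‖)
    (Eventually.of_forall fun n => by positivity) (fun n => norm_nonneg _)
    (fun n => norm_nonneg _) (fun n => ?_) ha ?_
  · have h1 : Design.sndBlock ((D n).residual (u n) ((D n).μ + ξ n))
        - (D n).B.toEuclideanLin (ξ n)
        = Design.sndBlock ((D n).fitError (u n) ((D n).μ + ξ n)) := by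
      rw [← Design.sndBlock_Q, Design.residual_eq_fitError]
      ext i
      simp [Design.sndBlock]
    refine (abs_norm_sub_norm_le _ _).trans ?_
    rw [h1]
    have := Design.norm_sq_eq_blocks ((D n).fitError (u n) ((D n).μ + ξ n))
    refine abs_le_of_sq_le_sq' ?_ (norm_nonneg _) |>.2
    linarith [sq_nonneg ‖Design.fstBlock ((D n).fitError (u n) ((D n).μ + ξ n))‖]
  · have h1 : Tendsto (fun n : ℕ => (√(n : ℝ))⁻¹) l (𝓝 0) :=
      (tendsto_inv_atTop_zero.comp
        (Real.tendsto_sqrt_atTop.comp tendsto_natCast_atTop_atTop)).mono_left hl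
    have h2 := tendsto_zero_of_isBigO_one ((isBigO_natCast_div_of_isTheta hnb).mono hl)
      (by simpa using he.mul h1)
    refine h2.congr' ?_
    filter_upwards [hl (eventually_gt_atTop 0)] with n hn0
    have hn0' : (0 : ℝ) < n := by exact_mod_cast hn0
    have h3 : (√(n : ℝ)) ≠ 0 := (Real.sqrt_pos.2 hn0').ne'
    have h4 : (n : ℝ) = √(n : ℝ) * √(n : ℝ) := (Real.mul_self_sqrt hn0'.le).symm
    field_simp
    rw [sq (√(n : ℝ)), ← h4]
    ring

theorem DesignConditions.tendsto_sigmaNuSqHat (h : DesignConditions D s σν2 σε2 σa2 dbar)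
    (hσν : 0 ≤ σν2) (hσε : 0 < σε2) (hσa : 0 < σa2) (hdbar : 0 < dbar)
    (hna : (fun n => (na n : ℝ)) =Θ[atTop] fun n : ℕ => (n : ℝ))
    (hl : l ≤ atTop) (ξ : ∀ n, EuclideanSpace ℝ (Fin n))
    (he : Tendsto (fun n : ℕ => ‖(D n).fitError (u n) ((D n).μ + ξ n)‖ ^ 2 / √n) l (𝓝 0))
    (hs : Tendsto (fun n => (D n).sigmaEpsSqHat (u n) ((D n).μ + ξ n)) l (𝓝 σε2))
    (hb : Tendsto (fun n : ℕ => 1 / (D n).Dinv.trace *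
      ‖((D n).whiten * (D n).A).toEuclideanLin (ξ n)‖ ^ 2) l (𝓝 (σν2 * dbar + σε2))) :
    Tendsto (fun n => (D n).sigmaNuSqHat (u n) ((D n).μ + ξ n)) l (𝓝 (σν2 * dbar)) := by
  have hpos := hl (h.trace_eventually_pos hdbar)
  simp only [Design.sigmaNuSqHat_eq]
  rw [show σν2 * dbar = σν2 * dbar + σε2 - σε2 by ring]
  refine Tendsto.sub ?_ hs
  refine tendsto_mul_sq_of_abs_sub_le
    (y := fun n => √(‖(D n).noiseVar σν2 σε2‖ / σε2)
      * ‖(D n).fitError (u n) ((D n).μ + ξ n)‖)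
    (Eventually.mono hpos fun n hn => by positivity) (fun n => norm_nonneg _)
    (fun n => by positivity) (fun n => ?_) hb ?_
  · have h1 : (D n).whiten.toEuclideanLin
          (Design.fstBlock ((D n).residual (u n) ((D n).μ + ξ n)))
        - ((D n).whiten * (D n).A).toEuclideanLin (ξ n)
        = (D n).whiten.toEuclideanLin
          (Design.fstBlock ((D n).fitError (u n) ((D n).μ + ξ n))) := by
      rw [toEuclideanLin_mul_apply, ← map_sub, ← Design.fstBlock_Q, Design.residual_eq_fitError]
      congr 1
      ext i
      simp [Design.fstBlock]
    refine (abs_norm_sub_norm_le _ _).trans ?_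
    rw [h1]
    have h2 := Design.norm_sq_eq_blocks ((D n).fitError (u n) ((D n).μ + ξ n))
    have h3 := Design.norm_whiten_sq_le (h.reduction n) hσν hσε
      (Design.fstBlock ((D n).fitError (u n) ((D n).μ + ξ n)))
    refine abs_le_of_sq_le_sq' (h3.trans ?_) (by positivity) |>.2
    rw [mul_pow, Real.sq_sqrt (by positivity), h2]
    gcongr
    linarith [sq_nonneg ‖Design.sndBlock ((D n).fitError (u n) ((D n).μ + ξ n))‖]
  -- The whitened fit error factors as `(n / Tr D⁻¹) · (‖ω‖_∞ / √n) · (‖e‖² / √n)`: a bounded factor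
  -- and two vanishing ones.
  · have h1 := tendsto_zero_of_isBigO_one ((h.isBigO_div_trace hna).mono hl)
      (by simpa using ((h.tendsto_norm_noiseVar_div hσa hdbar hna).mono_left hl).mul he)
    have h2 := h1.div_const σε2
    rw [zero_div] at h2
    refine h2.congr' ?_
    filter_upwards [hl (eventually_gt_atTop 0), hpos] with n hn0 hn
    have hn0' : (0 : ℝ) < n := by exact_mod_cast hn0
    have h3 : (√(n : ℝ)) ≠ 0 := (Real.sqrt_pos.2 hn0').ne'
    have h4 : (n : ℝ) = √(n : ℝ) * √(n : ℝ) := (Real.mul_self_sqrt hn0'.le).symm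
    rw [mul_pow, Real.sq_sqrt (by positivity)]
    field_simp
    rw [sq (√(n : ℝ)), ← h4]
    ring

/-- The plug-in vector `a 1 + b d⁻¹` differs from `ω` by `(a - σ_ν²) 1 + (b - σ_ε²) d⁻¹`, and both
directions have bounded norm after scaling by `√n / Tr D⁻¹`. -/
theorem DesignConditions.tendsto_sum_sq (h : DesignConditions D s σν2 σε2 σa2 dbar)
    (hσν : 0 ≤ σν2) (hσε : 0 < σε2)
    (hna : (fun n => (na n : ℝ)) =Θ[atTop] fun n : ℕ => (n : ℝ))
    (hl : l ≤ atTop) {a b : ℕ → ℝ} (ha : Tendsto a l (𝓝 σν2)) (hb : Tendsto b l (𝓝 σε2)) :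
    Tendsto (fun n : ℕ => 2 * (n : ℝ) * (∑ k, (a n + ((D n).d k)⁻¹ * b n) ^ 2)
      / (D n).Dinv.trace ^ 2) l (𝓝 σa2) := by
  let one : ∀ n, EuclideanSpace ℝ (Fin (na n)) := fun n => WithLp.toLp 2 fun _ => 1
  let x : ∀ n, EuclideanSpace ℝ (Fin (na n)) := fun n => WithLp.toLp 2 fun k => ((D n).d k)⁻¹
  let w : ∀ n, EuclideanSpace ℝ (Fin (na n)) := fun n => WithLp.toLp 2 ((D n).noiseVar σν2 σε2)
  have hone : ∀ n, ‖one n‖ = √(na n) := fun n => by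
    simp [one, EuclideanSpace.norm_eq]
  have hx : ∀ n, ‖x n‖ ≤ ‖w n‖ / σε2 := fun n => by
    rw [le_div_iff₀ hσε, EuclideanSpace.norm_eq, EuclideanSpace.norm_eq]
    refine abs_le_of_sq_le_sq' ?_ (by positivity) |>.2
    rw [mul_pow, Real.sq_sqrt (by positivity), Real.sq_sqrt (by positivity), Finset.sum_mul]
    refine Finset.sum_le_sum fun k _ => ?_
    have hd := inv_pos.2 ((h.reduction n).d_pos k)
    simp only [x, w, Design.noiseVar, Real.norm_eq_abs, sq_abs, ← mul_pow]
    gcongr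
    linarith
  have key := tendsto_mul_sq_of_abs_sub_le (l := l)
    (c := fun n : ℕ => 2 * (n : ℝ) / (D n).Dinv.trace ^ 2)
    (x := fun n => ‖w n‖) (z := fun n => ‖a n • one n + b n • x n‖)
    (y := fun n => |a n - σν2| * √(na n) + |b n - σε2| * (‖w n‖ / σε2)) (A := σa2)
    (Eventually.of_forall fun n => by positivity) (fun n => norm_nonneg _)
    (fun n => by positivity) (fun n => ?_) ?_ ?_
  · refine key.congr fun n => ?_
    rw [EuclideanSpace.real_norm_sq_eq]
    simp only [one, x, PiLp.add_apply, PiLp.smul_apply, smul_eq_mul, mul_one, mul_comm (b n)]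
    ring
  · have h1 : a n • one n + b n • x n - w n = (a n - σν2) • one n + (b n - σε2) • x n := by
      ext k
      simp only [one, x, w, Design.noiseVar, PiLp.add_apply, PiLp.sub_apply, PiLp.smul_apply,
        smul_eq_mul]
      ring
    refine (abs_norm_sub_norm_le _ _).trans ?_
    rw [h1]
    refine (norm_add_le _ _).trans ?_
    rw [norm_smul, norm_smul, hone, Real.norm_eq_abs, Real.norm_eq_abs]
    gcongr
    exact hx n
  · refine (h.tendsto_σa2.mono_left hl).congr fun n => ?_
    ring
  · have h1 : Tendsto (fun n => (a n - σν2) ^ 2) l (𝓝 0) := by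
      simpa using (ha.sub_const σν2).pow 2
    have h2 : Tendsto (fun n => (b n - σε2) ^ 2) l (𝓝 0) := by
      simpa using (hb.sub_const σε2).pow 2
    have h3 := tendsto_zero_of_isBigO_one
      (((h.isBigO_div_trace hna).mul (h.tendsto_dbar.isBigO_one ℝ)).mono hl |>.congr_right
        fun _ => one_mul _) h1
    have h4 := tendsto_zero_of_isBigO_one ((h.tendsto_σa2.isBigO_one ℝ).mono hl) h2
    have h5 := (h3.const_mul 4).add (h4.const_mul (2 / σε2 ^ 2))
    rw [mul_zero, mul_zero, add_zero] at h5
    refine squeeze_zero (fun n => by positivity) (fun n => ?_) h5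
    have h6 := add_sq_le (a := |a n - σν2| * √(na n)) (b := |b n - σε2| * (‖w n‖ / σε2))
    calc _ ≤ 2 * (n : ℝ) / (D n).Dinv.trace ^ 2 * (2 * ((|a n - σν2| * √(na n)) ^ 2
          + (|b n - σε2| * (‖w n‖ / σε2)) ^ 2)) := by gcongr
      _ = _ := by
        rw [mul_pow, mul_pow, sq_abs, sq_abs, Real.sq_sqrt (by positivity), div_pow]
        ring

/-- The variance estimators converge along every realisation for which the noise terms
converge. -/
theorem DesignConditions.tendsto_estimators (h : DesignConditions D s σν2 σε2 σa2 dbar)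
    (hσν : 0 ≤ σν2) (hσε : 0 < σε2) (hσa : 0 < σa2) (hdbar : 0 < dbar)
    (hna : (fun n => (na n : ℝ)) =Θ[atTop] fun n : ℕ => (n : ℝ))
    (hnb : (fun n => (nb n : ℝ)) =Θ[atTop] fun n : ℕ => (n : ℝ))
    (hσb_lim : Tendsto (fun n : ℕ => 2 * σε2 ^ 2 * (n : ℝ) / (nb n : ℝ)) atTop (𝓝 σb2))
    (hu_le : ∀ n, u n ≤ p n) (hus : ∀ᶠ n in atTop, s n ≤ u n)
    (hulog : Tendsto (fun n : ℕ => (u n : ℝ) * Real.log (p n) / √n) atTop (𝓝 0))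
    (hl : l ≤ atTop) (ξ : ∀ n, EuclideanSpace ℝ (Fin n)) {K : ℕ → ℝ}
    (hK : ∀ n, ∀ m ∈ models (p n) (u n), ‖(extSpan ((D n).Q * (D n).X)
      ((D n).Q.toEuclideanLin (D n).μ) m).starProjection ((D n).Q.toEuclideanLin (ξ n))‖ ^ 2 ≤ K n)
    (hK0 : Tendsto (fun n : ℕ => K n / √n) l (𝓝 0))
    (ha : Tendsto (fun n : ℕ => 1 / (nb n : ℝ) * ‖(D n).B.toEuclideanLin (ξ n)‖ ^ 2) l (𝓝 σε2))
    (hb : Tendsto (fun n : ℕ => 1 / (D n).Dinv.trace *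
      ‖((D n).whiten * (D n).A).toEuclideanLin (ξ n)‖ ^ 2) l (𝓝 (σν2 * dbar + σε2))) :
    Tendsto (fun n => (D n).sigmaASqHat (u n) ((D n).μ + ξ n)) l (𝓝 σa2) ∧
    Tendsto (fun n => (D n).sigmaBSqHat (u n) ((D n).μ + ξ n)) l (𝓝 σb2) := by
  have he := h.tendsto_norm_fitError hl hu_le hus hulog ξ hK hK0
  have hs := DesignConditions.tendsto_sigmaEpsSqHat hnb hl ξ he ha
  have hn := h.tendsto_sigmaNuSqHat hσν hσε hσa hdbar hna hl ξ he hs hb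
  have hd := hn.div (h.tendsto_dbar.mono_left hl) hdbar.ne'
  rw [mul_div_cancel_right₀ _ hdbar.ne'] at hd
  constructor
  · exact h.tendsto_sum_sq hσν hσε hna hl hd hs
  · have h1 := (hσb_lim.mono_left hl).mul ((hs.pow 2).div_const (σε2 ^ 2))
    rw [div_self (by positivity), mul_one] at h1
    refine h1.congr fun n => ?_
    rw [Design.sigmaBSqHat]
    field_simp

end Limits

/-! ### Convergence in probability of noise norms, and common subsequences. -/

section InMeasure

variable {Ω : Type*} [MeasurableSpace Ω] {P : Measure Ω}

theorem tendstoInMeasure_mul_norm_sq {ι : ℕ → Type*} [∀ n, Fintype (ι n)]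
    [∀ n, DecidableEq (ι n)] {X : ∀ n, Ω → EuclideanSpace ℝ (ι n)} {w : ∀ n, ι n → ℝ}
    (hw : ∀ n i, 0 ≤ w n i)
    (hX : ∀ n, HasLaw (X n) (multivariateGaussian 0 (Matrix.diagonal (w n))) P)
    {c : ℕ → ℝ} (hc : ∀ n, 0 ≤ c n) {A : ℝ}
    (hA : Tendsto (fun n => c n * ∑ i, w n i) atTop (𝓝 A))
    (h0 : Tendsto (fun n => c n ^ 2 * ∑ i, w n i ^ 2) atTop (𝓝 0)) :
    TendstoInMeasure P (fun n ω => c n * ‖X n ω‖ ^ 2) atTop fun _ => A := by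
  rw [tendstoInMeasure_iff_dist]
  intro δ hδ
  set C := Var[fun x : ℝ => x ^ 2; gaussianReal 0 1]
  have hlim : Tendsto (fun n => ENNReal.ofReal
      (C * (c n ^ 2 * ∑ i, w n i ^ 2) / (δ / 2) ^ 2)) atTop (𝓝 0) := by
    have := ENNReal.tendsto_ofReal ((h0.const_mul C).div_const ((δ / 2) ^ 2))
    simpa using this
  refine tendsto_of_tendsto_of_tendsto_of_le_of_le' tendsto_const_nhds hlim
    (Eventually.of_forall fun _ => zero_le) ?_
  filter_upwards [hA.eventually (Metric.ball_mem_nhds A (half_pos hδ))] with n hn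
  rw [Real.dist_eq] at hn
  -- Dividing the deviation by `c n` needs `c n > 0`; if `c n = 0`, closeness of the centring to `A`
  -- already makes the event empty.
  rcases (hc n).eq_or_lt with hcn | hcn
  · refine le_trans (le_of_eq ?_) zero_le
    convert measure_empty (μ := P)
    ext ω
    simp only [Set.mem_ofPred_eq, Set.mem_empty_iff_false, iff_false, not_le, Real.dist_eq]
    rw [← hcn] at hn ⊢
    rw [zero_mul] at hn ⊢
    linarith
  · refine (measure_mono fun ω hω => ?_).trans
      ((measure_norm_sq_sub_ge_le (hw n) (hX n) (t := δ / 2 / c n) (by positivity)).trans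
        (le_of_eq ?_))
    · simp only [Set.mem_ofPred_eq, Real.dist_eq] at hω ⊢
      rw [div_le_iff₀' hcn]
      nth_rw 1 [← abs_of_pos hcn]
      rw [← abs_mul, mul_sub]
      have h1 := abs_sub_le (c n * ‖X n ω‖ ^ 2) (c n * ∑ i, w n i) A
      linarith
    · congr 1
      change C * _ / _ = _
      field_simp

theorem exists_common_subseq {f g k : ℕ → Ω → ℝ} {a b c : Ω → ℝ}
    (hf : TendstoInMeasure P f atTop a) (hg : TendstoInMeasure P g atTop b)
    (hk : TendstoInMeasure P k atTop c) : ∃ ns : ℕ → ℕ, StrictMono ns ∧ ∀ᵐ ω ∂P,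
      Tendsto (fun i => f (ns i) ω) atTop (𝓝 (a ω)) ∧
      Tendsto (fun i => g (ns i) ω) atTop (𝓝 (b ω)) ∧
      Tendsto (fun i => k (ns i) ω) atTop (𝓝 (c ω)) := by
  obtain ⟨n1, hn1, h1⟩ := hf.exists_seq_tendsto_ae
  obtain ⟨n2, hn2, h2⟩ := (hg.comp hn1.tendsto_atTop).exists_seq_tendsto_ae
  obtain ⟨n3, hn3, h3⟩ := (hk.comp (hn1.comp hn2).tendsto_atTop).exists_seq_tendsto_ae
  refine ⟨n1 ∘ n2 ∘ n3, hn1.comp (hn2.comp hn3), ?_⟩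
  filter_upwards [h1, h2, h3] with ω h1 h2 h3
  exact ⟨h1.comp (hn2.comp hn3).tendsto_atTop, h2.comp hn3.tendsto_atTop, h3⟩

end InMeasure

/-! ### Covariances in the reduced models and the maximal projected noise. -/

namespace Design

variable {n p v r na nb : ℕ} {D : Design n p v r na nb} {Ω : Type*} [MeasurableSpace Ω]
  {P : Measure Ω} [IsProbabilityMeasure P] {ν : Ω → EuclideanSpace ℝ (Fin v)}
  {ε : Ω → EuclideanSpace ℝ (Fin n)} {σν2 σε2 : ℝ}

/-- The covariance matrix of the noise vector `Z ν + ε`. -/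
def noiseCov (D : Design n p v r na nb) (σν2 σε2 : ℝ) : Matrix (Fin n) (Fin n) ℝ :=
  D.Z * (σν2 • (1 : Matrix (Fin v) (Fin v) ℝ)) * D.Z.transpose
    + σε2 • (1 : Matrix (Fin n) (Fin n) ℝ)

theorem posSemidef_smul_one {ι : Type*} [Fintype ι] [DecidableEq ι] {c : ℝ} (hc : 0 ≤ c) :
    (c • (1 : Matrix ι ι ℝ)).PosSemidef :=
  Matrix.PosSemidef.one.smul hc

theorem posSemidef_noiseCov (hσν : 0 ≤ σν2) (hσε : 0 ≤ σε2) :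
    (D.noiseCov σν2 σε2).PosSemidef := by
  refine Matrix.PosSemidef.add ?_ (posSemidef_smul_one hσε)
  simpa using (posSemidef_smul_one hσν).mul_mul_conjTranspose_same D.Z

theorem hasLaw_noise (hσν : 0 ≤ σν2) (hσε : 0 ≤ σε2)
    (hν : HasLaw ν (multivariateGaussian 0 (σν2 • 1)) P)
    (hε : HasLaw ε (multivariateGaussian 0 (σε2 • 1)) P) (hνε : IndepFun ν ε P) :
    HasLaw (fun ω => D.Z.toEuclideanLin (ν ω) + ε ω)
      (multivariateGaussian 0 (D.noiseCov σν2 σε2)) P := by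
  refine hasLaw_add_multivariateGaussian ?_ (posSemidef_smul_one hσε)
    (hasLaw_toEuclideanLin (posSemidef_smul_one hσν) hν D.Z) hε
    (hνε.comp (measurable_toEuclideanLin D.Z) measurable_id)
  simpa using (posSemidef_smul_one hσν).mul_mul_conjTranspose_same D.Z

theorem IsReduction.B_cov (h : D.IsReduction) :
    D.B * D.noiseCov σν2 σε2 * D.B.transpose = Matrix.diagonal fun _ => σε2 := by
  rw [noiseCov, Matrix.mul_add, Matrix.add_mul, ← Matrix.mul_assoc, ← Matrix.mul_assoc, h.B_Z]
  simp [h.orthonormal_B, ← Matrix.smul_one_eq_diagonal]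

theorem IsReduction.Q_cov (h : D.IsReduction) :
    D.Q * D.noiseCov σν2 σε2 * D.Q.transpose
      = σν2 • (D.Q * D.Z * D.Z.transpose * D.Q.transpose) + σε2 • 1 := by
  rw [noiseCov, Matrix.mul_add, Matrix.add_mul]
  simp [h.Q_mul_transpose, Matrix.mul_assoc]

theorem IsReduction.whiten_cov (h : D.IsReduction) :
    (D.whiten * D.A) * D.noiseCov σν2 σε2 * (D.whiten * D.A).transpose
      = Matrix.diagonal (D.noiseVar σν2 σε2) := by
  have hV : D.V.transpose * D.V = 1 := (Matrix.mem_orthogonalGroup_iff' _ _).1 h.V_orthogonal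
  have h1 : D.A * D.noiseCov σν2 σε2 * D.A.transpose
      = D.V * Matrix.diagonal (fun k => σν2 * D.d k + σε2) * D.V.transpose := by
    have hV' : D.V * D.V.transpose = 1 := (Matrix.mem_orthogonalGroup_iff _ _).1 h.V_orthogonal
    have h2 : Matrix.diagonal (fun k => σν2 * D.d k + σε2)
        = σν2 • Matrix.diagonal D.d + σε2 • 1 := by
      rw [Matrix.smul_one_eq_diagonal, ← Matrix.diagonal_smul, Matrix.diagonal_add]
      rfl
    have h3 : D.A * D.noiseCov σν2 σε2 * D.A.transpose
        = σν2 • (D.A * D.Z * D.Z.transpose * D.A.transpose) + σε2 • (D.A * D.A.transpose) := by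
      rw [noiseCov, Matrix.mul_add, Matrix.add_mul]
      simp [Matrix.mul_assoc]
    rw [h3, h2, h.spectral, h.orthonormal_A, Matrix.mul_add, Matrix.add_mul]
    simp [hV']
  have h4 : (D.whiten * D.A) * D.noiseCov σν2 σε2 * (D.whiten * D.A).transpose
      = D.whiten * (D.A * D.noiseCov σν2 σε2 * D.A.transpose) * D.whiten.transpose := by
    simp only [Matrix.transpose_mul, Matrix.mul_assoc]
  rw [h4, h1, whiten]
  have h5 : ∀ E F : Matrix (Fin na) (Fin na) ℝ,
      E * D.V.transpose * (D.V * F * D.V.transpose) * (E * D.V.transpose).transpose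
        = E * F * E.transpose := fun E F => by
    rw [Matrix.transpose_mul, Matrix.transpose_transpose]
    calc _ = E * (D.V.transpose * D.V) * F * (D.V.transpose * D.V) * E.transpose := by
          simp only [Matrix.mul_assoc]
      _ = _ := by simp [hV]
  rw [h5, Matrix.diagonal_transpose, Matrix.diagonal_mul_diagonal, Matrix.diagonal_mul_diagonal]
  congr 1
  ext k
  have hd := h.d_pos k
  have h6 := Real.mul_self_sqrt hd.le
  have h7 := (Real.sqrt_pos.2 hd).ne'
  simp only [noiseVar]
  rw [mul_right_comm, ← mul_inv, h6]
  field_simp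

/-- The largest squared norm of the projections of the stacked noise onto the extended model
spaces. -/
noncomputable def supNoise (D : Design n p v r na nb) {u : ℕ} (hu : u ≤ p)
    (ξ : EuclideanSpace ℝ (Fin n)) : ℝ :=
  (models p u).sup' (models_nonempty hu) fun m =>
    ‖(extSpan (D.Q * D.X) (D.Q.toEuclideanLin D.μ) m).starProjection (D.Q.toEuclideanLin ξ)‖ ^ 2

theorem le_supNoise {u : ℕ} (hu : u ≤ p) (ξ : EuclideanSpace ℝ (Fin n)) {m : Finset (Fin p)}
    (hm : m ∈ models p u) :
    ‖(extSpan (D.Q * D.X) (D.Q.toEuclideanLin D.μ) m).starProjection (D.Q.toEuclideanLin ξ)‖ ^ 2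
      ≤ D.supNoise hu ξ :=
  Finset.le_sup' (fun m => ‖(extSpan (D.Q * D.X) (D.Q.toEuclideanLin D.μ) m).starProjection
    (D.Q.toEuclideanLin ξ)‖ ^ 2) hm

theorem supNoise_nonneg {u : ℕ} (hu : u ≤ p) (ξ : EuclideanSpace ℝ (Fin n)) :
    0 ≤ D.supNoise hu ξ := by
  obtain ⟨m, hm⟩ := models_nonempty hu
  exact (sq_nonneg _).trans (le_supNoise hu ξ hm)

/-- Union bound over at most `p ^ u` models, each contributing the tail of a projection onto a space
of dimension at most `u + 1`. -/
theorem measure_supNoise_ge_le (h : D.IsReduction) (hσν : 0 ≤ σν2) (hσε : 0 ≤ σε2)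
    {ξ : Ω → EuclideanSpace ℝ (Fin n)}
    (hξ : HasLaw ξ (multivariateGaussian 0 (D.noiseCov σν2 σε2)) P) {L : ℝ} (hL : 0 < L)
    (hlam : lambdaMax (σν2 • (D.Q * D.Z * D.Z.transpose * D.Q.transpose) + σε2 • 1) ≤ L)
    {u : ℕ} (hu : u ≤ p) {c : ℝ} (hc0 : 0 < c)
    (hc : Integrable (fun x : ℝ => Real.exp (c * x ^ 2)) (gaussianReal 0 1)) (t : ℝ) :
    P {ω | t ≤ D.supNoise hu (ξ ω)} ≤ ENNReal.ofReal (Real.exp (u * Real.log p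
      + (u + 1) * Real.log (∫ x : ℝ, Real.exp (c * x ^ 2) ∂gaussianReal 0 1)
      - c * (t / L))) := by
  set C := ∫ x : ℝ, Real.exp (c * x ^ 2) ∂gaussianReal 0 1
  have hC : 1 ≤ C := one_le_integral_exp_sq hc0 hc
  have hS := D.posSemidef_noiseCov hσν hσε
  have hlaw := hasLaw_toEuclideanLin hS hξ D.Q
  have hS' : (D.Q * D.noiseCov σν2 σε2 * D.Q.transpose).PosSemidef := by
    simpa using hS.mul_mul_conjTranspose_same D.Q
  have hbound : ∀ x : EuclideanSpace ℝ (Fin na ⊕ Fin nb),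
      ⟪x, (D.Q * D.noiseCov σν2 σε2 * D.Q.transpose).toEuclideanLin x⟫ ≤ L * ‖x‖ ^ 2 := fun x => by
    refine (inner_toEuclideanLin_le_lambdaMax hS'.isHermitian x).trans ?_
    rw [h.Q_cov]
    gcongr
  have hm : ∀ m ∈ models p u, P {ω | t ≤ ‖(extSpan (D.Q * D.X) (D.Q.toEuclideanLin D.μ)
      m).starProjection (D.Q.toEuclideanLin (ξ ω))‖ ^ 2}
      ≤ ENNReal.ofReal (C ^ (u + 1) * Real.exp (-(c * (t / L)))) := fun m hm =>
    measure_norm_sq_starProjection_ge_le hS' hlaw hL hbound _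
      ((finrank_extSpan_le _ _ m).trans (by rw [(Finset.mem_powersetCard.1 hm).2])) hc0 hc t
  calc _ ≤ P (⋃ m ∈ models p u, {ω | t ≤ ‖(extSpan (D.Q * D.X) (D.Q.toEuclideanLin D.μ)
      m).starProjection (D.Q.toEuclideanLin (ξ ω))‖ ^ 2}) := by
        refine measure_mono fun ω hω => ?_
        obtain ⟨m, hm, hm'⟩ := (Finset.le_sup'_iff _).1 (show t ≤ D.supNoise hu (ξ ω) from hω)
        exact Set.mem_biUnion hm hm'
    _ ≤ ∑ m ∈ models p u, P {ω | t ≤ ‖(extSpan (D.Q * D.X) (D.Q.toEuclideanLin D.μ)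
      m).starProjection (D.Q.toEuclideanLin (ξ ω))‖ ^ 2} := measure_biUnion_finset_le _ _
    _ ≤ ∑ m ∈ models p u, ENNReal.ofReal (C ^ (u + 1) * Real.exp (-(c * (t / L)))) :=
        Finset.sum_le_sum hm
    _ = ENNReal.ofReal ((models p u).card * (C ^ (u + 1) * Real.exp (-(c * (t / L))))) := by
        rw [Finset.sum_const, nsmul_eq_mul,
          ENNReal.ofReal_mul (p := ((models p u).card : ℝ)) (by positivity),
          ENNReal.ofReal_natCast]
    _ ≤ _ := by
        refine ENNReal.ofReal_le_ofReal ?_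
        have h1 : ((models p u).card : ℝ) ≤ Real.exp (u * Real.log p) := by
          rw [← Real.log_le_iff_le_exp (by exact_mod_cast (models_nonempty hu).card_pos)]
          exact log_card_models_le hu
        have h2 : C ^ (u + 1) = Real.exp ((u + 1) * Real.log C) := by
          rw [mul_comm, Real.exp_mul, Real.exp_log (by linarith)]
          exact_mod_cast (Real.rpow_natCast C (u + 1)).symm
        rw [sub_eq_add_neg, Real.exp_add, Real.exp_add, ← h2, mul_assoc]
        gcongr

end Design

/-! ### Consistency for non-random designs. -/

section Fixed

/-- The summand `1` covers `p ≤ 1`, where `log p` vanishes. Hence the rate for `u log p` also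
controls the dimension `u + 1`. -/
theorem natCast_le_one_add_mul_log {u p : ℕ} (hu : u ≤ p) :
    (u : ℝ) ≤ 1 + u * Real.log p / Real.log 2 := by
  have h2 : 0 < Real.log 2 := Real.log_pos (by norm_num)
  rcases le_or_gt p 1 with hp | hp
  · have h1 : (u : ℝ) ≤ 1 := by exact_mod_cast hu.trans hp
    have := Real.log_natCast_nonneg p
    have : 0 ≤ u * Real.log p / Real.log 2 := by positivity
    linarith
  · have h1 : Real.log 2 ≤ Real.log p := Real.log_le_log (by norm_num) (by exact_mod_cast hp)
    have h3 : (u : ℝ) ≤ u * Real.log p / Real.log 2 := by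
      rw [le_div_iff₀ h2]
      gcongr
    linarith

theorem tendsto_div_sqrt_of_mul_log {u p : ℕ → ℕ} (hu_le : ∀ n, u n ≤ p n)
    (hulog : Tendsto (fun n : ℕ => (u n : ℝ) * Real.log (p n) / √n) atTop (𝓝 0)) :
    Tendsto (fun n : ℕ => ((u n : ℝ) + 1) / √n) atTop (𝓝 0) := by
  have h1 : Tendsto (fun n : ℕ => (√(n : ℝ))⁻¹) atTop (𝓝 0) :=
    tendsto_inv_atTop_zero.comp (Real.tendsto_sqrt_atTop.comp tendsto_natCast_atTop_atTop)
  have h2 := (h1.const_mul 2).add (hulog.div_const (Real.log 2))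
  simp only [mul_zero, zero_div, add_zero] at h2
  refine squeeze_zero (fun n => by positivity) (fun n => ?_) h2
  have h3 := natCast_le_one_add_mul_log (hu_le n)
  calc _ ≤ (2 + u n * Real.log (p n) / Real.log 2) / √n := by
        exact div_le_div_of_nonneg_right (by linarith) (Real.sqrt_nonneg _)
    _ = _ := by ring

variable {p v r na nb s u : ℕ → ℕ} {σν2 σε2 σa2 σb2 dbar : ℝ}
  {D : ∀ n, Design n (p n) (v n) (r n) (na n) (nb n)}
  {Ω : Type*} [MeasurableSpace Ω] {P : Measure Ω} [IsProbabilityMeasure P]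

theorem DesignConditions.tendstoInMeasure_supNoise (h : DesignConditions D s σν2 σε2 σa2 dbar)
    (hσν : 0 ≤ σν2) (hσε : 0 < σε2) (hu_le : ∀ n, u n ≤ p n)
    (hulog : Tendsto (fun n : ℕ => (u n : ℝ) * Real.log (p n) / √n) atTop (𝓝 0))
    {ξ : ∀ n, Ω → EuclideanSpace ℝ (Fin n)}
    (hξ : ∀ n, HasLaw (ξ n) (multivariateGaussian 0 ((D n).noiseCov σν2 σε2)) P) :
    TendstoInMeasure P (fun n ω => (D n).supNoise (hu_le n) (ξ n ω) / √n) atTop fun _ => 0 := by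
  -- Fernique's theorem supplies some exponent `c > 0`; its value is irrelevant.
  obtain ⟨c, hc0, hc⟩ := IsGaussian.exists_integrable_exp_sq (gaussianReal 0 1)
  simp only [Real.norm_eq_abs, sq_abs] at hc
  obtain ⟨L, hL, hLb⟩ := h.lambdaMax_bounded.exists_pos
  rw [tendstoInMeasure_iff_dist]
  intro δ hδ
  set C := Real.log (∫ x : ℝ, Real.exp (c * x ^ 2) ∂gaussianReal 0 1)
  have hsqrt : Tendsto (fun n : ℕ => √(n : ℝ)) atTop atTop :=
    Real.tendsto_sqrt_atTop.comp tendsto_natCast_atTop_atTop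
  -- At the threshold `δ √n` the exponent is `√n` times a factor tending to `-c δ / L < 0`.
  have h1 : Tendsto (fun n : ℕ => √(n : ℝ) * (u n * Real.log (p n) / √n + (u n + 1) / √n * C
      - c * (δ / L))) atTop atBot := by
    refine hsqrt.atTop_mul_neg (C := -(c * (δ / L))) (neg_neg_of_pos (by positivity)) ?_
    simpa using (hulog.add ((tendsto_div_sqrt_of_mul_log hu_le hulog).mul_const C)).sub_const
      (c * (δ / L))
  have h2 := ENNReal.tendsto_ofReal (Real.tendsto_exp_atBot.comp h1)
  rw [ENNReal.ofReal_zero] at h2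
  refine tendsto_of_tendsto_of_tendsto_of_le_of_le' tendsto_const_nhds h2
    (Eventually.of_forall fun _ => zero_le) ?_
  filter_upwards [hLb.bound, eventually_gt_atTop 0] with n hn hn0
  have hn0' : 0 < √(n : ℝ) := Real.sqrt_pos.2 (by exact_mod_cast hn0)
  have hlam := (le_abs_self _).trans (hn.trans (by simp : L * ‖(1 : ℝ)‖ ≤ L))
  refine (measure_mono fun ω hω => ?_).trans (((D n).measure_supNoise_ge_le (h.reduction n) hσν
    hσε.le (hξ n) hL hlam (hu_le n) hc0 hc (δ * √n)).trans (le_of_eq ?_))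
  · simp only [Set.mem_ofPred_eq, Real.dist_eq, sub_zero] at hω ⊢
    rwa [abs_of_nonneg (div_nonneg ((D n).supNoise_nonneg _ _) hn0'.le), le_div_iff₀ hn0'] at hω
  · have hCdef : Real.log (∫ x : ℝ, Real.exp (c * x ^ 2) ∂gaussianReal 0 1) = C := rfl
    rw [hCdef, Function.comp_apply]
    congr 2
    field_simp

theorem DesignConditions.tendstoInMeasure_norm_B (h : DesignConditions D s σν2 σε2 σa2 dbar)
    (hσν : 0 ≤ σν2) (hσε : 0 < σε2)
    (hnb : (fun n => (nb n : ℝ)) =Θ[atTop] fun n : ℕ => (n : ℝ))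
    {ξ : ∀ n, Ω → EuclideanSpace ℝ (Fin n)}
    (hξ : ∀ n, HasLaw (ξ n) (multivariateGaussian 0 ((D n).noiseCov σν2 σε2)) P) :
    TendstoInMeasure P (fun n ω => 1 / (nb n : ℝ) * ‖(D n).B.toEuclideanLin (ξ n ω)‖ ^ 2)
      atTop fun _ => σε2 := by
  have hnb' : Tendsto (fun n => (nb n : ℝ)) atTop atTop := by
    have h1 := hnb.2.trans_tendsto_norm_atTop (by simpa using tendsto_natCast_atTop_atTop)
    simpa using h1
  refine tendstoInMeasure_mul_norm_sq (w := fun n _ => σε2) (fun _ _ => hσε.le) (fun n => ?_)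
    (fun n => by positivity) ?_ ?_
  · rw [← (h.reduction n).B_cov (σν2 := σν2)]
    exact hasLaw_toEuclideanLin ((D n).posSemidef_noiseCov hσν hσε.le) (hξ n) _
  · refine tendsto_const_nhds.congr' ?_
    filter_upwards [hnb'.eventually_gt_atTop 0] with n hn
    simp
    field_simp
  · have h1 := (tendsto_inv_atTop_zero.comp hnb').mul_const (σε2 ^ 2)
    rw [zero_mul] at h1
    refine h1.congr' ?_
    filter_upwards [hnb'.eventually_gt_atTop 0] with n hn
    simp
    field_simp

theorem DesignConditions.tendstoInMeasure_norm_whiten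
    (h : DesignConditions D s σν2 σε2 σa2 dbar)
    (hσν : 0 ≤ σν2) (hσε : 0 < σε2) (hdbar : 0 < dbar)
    {ξ : ∀ n, Ω → EuclideanSpace ℝ (Fin n)}
    (hξ : ∀ n, HasLaw (ξ n) (multivariateGaussian 0 ((D n).noiseCov σν2 σε2)) P) :
    TendstoInMeasure P (fun n ω => 1 / (D n).Dinv.trace *
      ‖((D n).whiten * (D n).A).toEuclideanLin (ξ n ω)‖ ^ 2)
      atTop fun _ => σν2 * dbar + σε2 := by
  have htr : ∀ n, (D n).Dinv.trace = ∑ k, ((D n).d k)⁻¹ := fun n => by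
    simp [Design.Dinv]
  have hd : ∀ n k, 0 < ((D n).d k)⁻¹ := fun n k => inv_pos.2 ((h.reduction n).d_pos k)
  refine tendstoInMeasure_mul_norm_sq (w := fun n => (D n).noiseVar σν2 σε2)
    (fun n k => ?_) (fun n => ?_) (fun n => ?_) ?_ ?_
  · have := hd n k
    simp only [Design.noiseVar]
    positivity
  · rw [← (h.reduction n).whiten_cov]
    exact hasLaw_toEuclideanLin ((D n).posSemidef_noiseCov hσν hσε.le) (hξ n) _
  · rw [htr]
    exact one_div_nonneg.2 (Finset.sum_nonneg fun k _ => (hd n k).le)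
  · refine ((h.tendsto_dbar.const_mul σν2).add_const σε2).congr' ?_
    filter_upwards [h.trace_eventually_pos hdbar] with n hn
    have h1 : ∑ k, (D n).noiseVar σν2 σε2 k = na n * σν2 + σε2 * (D n).Dinv.trace := by
      simp [Design.noiseVar, Finset.sum_add_distrib, ← Finset.mul_sum, htr]
    rw [h1]
    field_simp
  -- The variance scale `‖ω‖₂² / (Tr D⁻¹)²` is the quantity converging to `σa2`, divided by `2 n`.
  · have h1 := h.tendsto_σa2.mul
      ((tendsto_inv_atTop_zero.comp tendsto_natCast_atTop_atTop).div_const (2 : ℝ))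
    rw [zero_div, mul_zero] at h1
    refine h1.congr' ?_
    filter_upwards [eventually_gt_atTop 0] with n hn
    have hn0' : (0 : ℝ) < n := by exact_mod_cast hn
    rw [EuclideanSpace.real_norm_sq_eq]
    simp only [Function.comp_apply]
    field_simp

/-- Consistency of the variance estimators for a non-random sequence of designs. -/
theorem DesignConditions.tendstoInMeasure_estimators
    (h : DesignConditions D s σν2 σε2 σa2 dbar)
    (hσν : 0 ≤ σν2) (hσε : 0 < σε2) (hσa : 0 < σa2) (hdbar : 0 < dbar)
    {ν : ∀ n, Ω → EuclideanSpace ℝ (Fin (v n))} {ε : ∀ n, Ω → EuclideanSpace ℝ (Fin n)}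
    (hν : ∀ n, HasLaw (ν n) (multivariateGaussian 0 (σν2 • 1)) P)
    (hε : ∀ n, HasLaw (ε n) (multivariateGaussian 0 (σε2 • 1)) P)
    (hνε : ∀ n, IndepFun (ν n) (ε n) P)
    (hna : (fun n => (na n : ℝ)) =Θ[atTop] fun n : ℕ => (n : ℝ))
    (hnb : (fun n => (nb n : ℝ)) =Θ[atTop] fun n : ℕ => (n : ℝ))
    (hσb_lim : Tendsto (fun n : ℕ => 2 * σε2 ^ 2 * (n : ℝ) / (nb n : ℝ)) atTop (𝓝 σb2))
    (hu_le : ∀ n, u n ≤ p n) (hus : ∀ᶠ n in atTop, s n ≤ u n)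
    (hulog : Tendsto (fun n : ℕ => (u n : ℝ) * Real.log (p n) / √n) atTop (𝓝 0)) :
    TendstoInMeasure P
      (fun n ω => (D n).sigmaASqHat (u n) ((D n).response (ν n ω) 0 (ε n ω))) atTop
      (fun _ => σa2) ∧
    TendstoInMeasure P
      (fun n ω => (D n).sigmaBSqHat (u n) ((D n).response (ν n ω) 0 (ε n ω))) atTop
      (fun _ => σb2) := by
  set ξ : ∀ n, Ω → EuclideanSpace ℝ (Fin n) := fun n ω => (D n).Z.toEuclideanLin (ν n ω) + ε n ω
  have hξ : ∀ n, HasLaw (ξ n) (multivariateGaussian 0 ((D n).noiseCov σν2 σε2)) P := fun n =>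
    Design.hasLaw_noise hσν hσε.le (hν n) (hε n) (hνε n)
  have hresp : ∀ n ω, (D n).response (ν n ω) 0 (ε n ω) = (D n).μ + ξ n ω := fun n ω => by
    simp [Design.response, ξ, add_assoc]
  have hY : ∀ n, AEMeasurable (fun ω => (D n).μ + ξ n ω) P := fun n =>
    (hξ n).aemeasurable.const_add _
  simp only [hresp]
  have hK := h.tendstoInMeasure_supNoise hσν hσε hu_le hulog hξ
  have ha := h.tendstoInMeasure_norm_B hσν hσε hnb hξ
  have hb := h.tendstoInMeasure_norm_whiten hσν hσε hdbar hξ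
  have hmA : ∀ n, AEStronglyMeasurable
      (fun ω => (D n).sigmaASqHat (u n) ((D n).μ + ξ n ω)) P := fun n =>
    ((Design.measurable_sigmaASqHat (D := fun _ => D n) measurable_const measurable_id
      (u n)).comp_aemeasurable (hY n)).aestronglyMeasurable
  have hmB : ∀ n, AEStronglyMeasurable
      (fun ω => (D n).sigmaBSqHat (u n) ((D n).μ + ξ n ω)) P := fun n =>
    ((Design.measurable_sigmaBSqHat (D := fun _ => D n) measurable_const measurable_id
      (u n)).comp_aemeasurable (hY n)).aestronglyMeasurable
  -- Every subsequence has a further one along which all three noise statistics converge almost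
  -- surely; there the deterministic result applies with `l` the image filter.
  have key : ∀ ns : ℕ → ℕ, StrictMono ns → ∃ ns' : ℕ → ℕ, StrictMono ns' ∧ ∀ᵐ ω ∂P,
      Tendsto (fun i => (D (ns (ns' i))).sigmaASqHat (u (ns (ns' i)))
        ((D (ns (ns' i))).μ + ξ (ns (ns' i)) ω)) atTop (𝓝 σa2) ∧
      Tendsto (fun i => (D (ns (ns' i))).sigmaBSqHat (u (ns (ns' i)))
        ((D (ns (ns' i))).μ + ξ (ns (ns' i)) ω)) atTop (𝓝 σb2) := by
    intro ns hns
    obtain ⟨ns', hns', hae⟩ := exists_common_subseq (hK.comp hns.tendsto_atTop)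
      (ha.comp hns.tendsto_atTop) (hb.comp hns.tendsto_atTop)
    refine ⟨ns', hns', ?_⟩
    filter_upwards [hae] with ω ⟨h1, h2, h3⟩
    have hl : map (ns ∘ ns') atTop ≤ atTop := (hns.comp hns').tendsto_atTop
    have := h.tendsto_estimators hσν hσε hσa hdbar hna hnb hσb_lim hu_le hus hulog hl
      (fun n => ξ n ω) (K := fun n => (D n).supNoise (hu_le n) (ξ n ω))
      (fun n m hm => Design.le_supNoise (hu_le n) _ hm) (tendsto_map'_iff.2 h1)
      (tendsto_map'_iff.2 h2) (tendsto_map'_iff.2 h3)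
    exact ⟨tendsto_map'_iff.1 this.1, tendsto_map'_iff.1 this.2⟩
  constructor
  · rw [exists_seq_tendstoInMeasure_atTop_iff hmA]
    intro ns hns
    obtain ⟨ns', hns', hae⟩ := key ns hns
    exact ⟨ns', hns', hae.mono fun ω hω => hω.1⟩
  · rw [exists_seq_tendstoInMeasure_atTop_iff hmB]
    intro ns hns
    obtain ⟨ns', hns', hae⟩ := key ns hns
    exact ⟨ns', hns', hae.mono fun ω hω => hω.2⟩

end Fixed

/-! ### Removing `γ` and conditioning on random designs. -/

namespace Design

variable {n p v r na nb : ℕ} {D : Design n p v r na nb}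

theorem IsReduction.residual_response (h : D.IsReduction) (u : ℕ) (ν : EuclideanSpace ℝ (Fin v))
    (γ : EuclideanSpace ℝ (Fin r)) (ε : EuclideanSpace ℝ (Fin n)) :
    D.residual u (D.response ν γ ε) = D.residual u (D.response ν 0 ε) := by
  have hQ : D.Q.toEuclideanLin (D.response ν γ ε) = D.Q.toEuclideanLin (D.response ν 0 ε) := by
    simp only [response, map_add, map_zero, ← toEuclideanLin_mul_apply, h.Q_mul_W,
      LinearMap.zero_apply]
  rw [residual, residual, betaHat, betaHat, hQ]

theorem IsReduction.sigmaEpsSqHat_response (h : D.IsReduction) (u : ℕ)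
    (ν : EuclideanSpace ℝ (Fin v)) (γ : EuclideanSpace ℝ (Fin r)) (ε : EuclideanSpace ℝ (Fin n)) :
    D.sigmaEpsSqHat u (D.response ν γ ε) = D.sigmaEpsSqHat u (D.response ν 0 ε) := by
  rw [sigmaEpsSqHat_eq, sigmaEpsSqHat_eq, h.residual_response]

theorem IsReduction.sigmaNuSqHat_response (h : D.IsReduction) (u : ℕ)
    (ν : EuclideanSpace ℝ (Fin v)) (γ : EuclideanSpace ℝ (Fin r)) (ε : EuclideanSpace ℝ (Fin n)) :
    D.sigmaNuSqHat u (D.response ν γ ε) = D.sigmaNuSqHat u (D.response ν 0 ε) := by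
  rw [sigmaNuSqHat_eq, sigmaNuSqHat_eq, h.residual_response, h.sigmaEpsSqHat_response]

theorem IsReduction.sigmaASqHat_response (h : D.IsReduction) (u : ℕ)
    (ν : EuclideanSpace ℝ (Fin v)) (γ : EuclideanSpace ℝ (Fin r)) (ε : EuclideanSpace ℝ (Fin n)) :
    D.sigmaASqHat u (D.response ν γ ε) = D.sigmaASqHat u (D.response ν 0 ε) := by
  rw [sigmaASqHat, sigmaASqHat, h.sigmaNuSqHat_response, h.sigmaEpsSqHat_response]

theorem IsReduction.sigmaBSqHat_response (h : D.IsReduction) (u : ℕ)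
    (ν : EuclideanSpace ℝ (Fin v)) (γ : EuclideanSpace ℝ (Fin r)) (ε : EuclideanSpace ℝ (Fin n)) :
    D.sigmaBSqHat u (D.response ν γ ε) = D.sigmaBSqHat u (D.response ν 0 ε) := by
  rw [sigmaBSqHat, sigmaBSqHat, h.sigmaEpsSqHat_response]

end Design

/-- Convergence in probability given almost every realisation of an independent component
implies convergence in probability. -/
theorem tendstoInMeasure_of_forall_ae_indep {Ω : Type*} [MeasurableSpace Ω] {P : Measure Ω}
    [IsProbabilityMeasure P] {α β : ℕ → Type*} [∀ n, MeasurableSpace (α n)]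
    [∀ n, MeasurableSpace (β n)] {D : ∀ n, Ω → α n} {ζ : ∀ n, Ω → β n}
    (hD : ∀ n, Measurable (D n)) (hζ : ∀ n, AEMeasurable (ζ n) P)
    (hind : ∀ n, IndepFun (D n) (ζ n) P) {T : ∀ n, α n × β n → ℝ} (hT : ∀ n, Measurable (T n))
    {c : ℝ} (h : ∀ᵐ ω ∂P, TendstoInMeasure P (fun n ω' => T n (D n ω, ζ n ω')) atTop fun _ => c) :
    TendstoInMeasure P (fun n ω => T n (D n ω, ζ n ω)) atTop fun _ => c := by
  intro δ hδ
  let B : ∀ n, Set (α n × β n) := fun n => {x | δ ≤ edist (T n x) c}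
  have hB : ∀ n, MeasurableSet (B n) := fun n =>
    measurableSet_le measurable_const ((hT n).edist measurable_const)
  have hslice : ∀ n d, P {ω' | δ ≤ edist (T n (d, ζ n ω')) c}
      = (P.map (ζ n)) (Prod.mk d ⁻¹' B n) := fun n d => by
    rw [Measure.map_apply_of_aemeasurable (hζ n) (measurable_prodMk_left (hB n))]
    rfl
  have hmeas : ∀ n, Measurable fun d => (P.map (ζ n)) (Prod.mk d ⁻¹' B n) := fun n => by
    have := Measure.isProbabilityMeasure_map (hζ n)
    exact measurable_measure_prodMk_left (hB n)
  -- By independence and Fubini the joint probability is the average over frozen designs of the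
  -- conditional probability. Only the joint law at each single `n` enters; dominated convergence
  -- with bound `1` then gives the limit.
  have hjoint : ∀ n, P {ω | δ ≤ edist (T n (D n ω, ζ n ω)) c}
      = ∫⁻ ω, P {ω' | δ ≤ edist (T n (D n ω, ζ n ω')) c} ∂P := fun n => by
    have := Measure.isProbabilityMeasure_map (hζ n)
    have hprod := (indepFun_iff_map_prod_eq_prod_map_map (hD n).aemeasurable (hζ n)).1 (hind n)
    have h1 : P {ω | δ ≤ edist (T n (D n ω, ζ n ω)) c}
        = P.map (fun ω => (D n ω, ζ n ω)) (B n) := by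
      rw [Measure.map_apply_of_aemeasurable ((hD n).aemeasurable.prodMk (hζ n)) (hB n)]
      rfl
    rw [h1, hprod, Measure.prod_apply (hB n), lintegral_map (hmeas n) (hD n)]
    simp_rw [hslice]
  simp_rw [hjoint]
  have hlim := tendsto_lintegral_of_dominated_convergence (μ := P)
    (F := fun n ω => P {ω' | δ ≤ edist (T n (D n ω, ζ n ω')) c}) (f := fun _ => 0) (fun _ => 1)
    (fun n => by
      simp_rw [hslice]
      exact (hmeas n).comp (hD n))
    (fun n => ae_of_all _ fun ω => prob_le_one) (by simp)
    (h.mono fun ω hω => hω δ hδ)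
  simpa using hlim

end MixedModel

/-! ### The main theorem. -/

theorem mainTheorem7
    {Ω : Type*} [MeasurableSpace Ω] (P : Measure Ω) [IsProbabilityMeasure P]
    -- dimensions, sparsity and size of the models, all depending on the sample size `n`
    (p v r na nb s u : ℕ → ℕ)
    -- parameters
    (σν2 σε2 σa2 σb2 dbar : ℝ)
    (hσν : 0 ≤ σν2) (hσε : 0 < σε2) (hσa : 0 < σa2) (hσb : 0 < σb2) (hdbar : 0 < dbar)
    -- designs, random effects and errors
    (D : ∀ n, Ω → MixedModel.Design n (p n) (v n) (r n) (na n) (nb n))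
    (ν : ∀ n, Ω → EuclideanSpace ℝ (Fin (v n)))
    (γ : ∀ n, Ω → EuclideanSpace ℝ (Fin (r n)))
    (ε : ∀ n, Ω → EuclideanSpace ℝ (Fin n))
    (hD : ∀ n, Measurable (D n))
    (hν : ∀ n, HasLaw (ν n) (multivariateGaussian 0 (σν2 • 1)) P)
    (hε : ∀ n, HasLaw (ε n) (multivariateGaussian 0 (σε2 • 1)) P)
    (hνε : ∀ n, IndepFun (ν n) (ε n) P)
    (hindep : ∀ n, IndepFun (D n) (fun ω => (ν n ω, ε n ω)) P)
    -- sparsity and sample sizes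
    (hu_le : ∀ n, u n ≤ p n)
    (hus : 0 ≤ liminf (fun n => (((u n : ℝ) - (s n : ℝ) : ℝ) : EReal)) atTop)
    (hulog : Tendsto (fun n : ℕ => (u n : ℝ) * Real.log (p n) / Real.sqrt n) atTop (𝓝 0))
    (hna : (fun n => (na n : ℝ)) =Θ[atTop] fun n : ℕ => (n : ℝ))
    (hnb : (fun n => (nb n : ℝ)) =Θ[atTop] fun n : ℕ => (n : ℝ))
    (hσb_lim : Tendsto (fun n : ℕ => 2 * σε2 ^ 2 * (n : ℝ) / (nb n : ℝ)) atTop (𝓝 σb2))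
    -- conditions on almost every realisation of the designs
    (hcond : ∀ᵐ ω ∂P, MixedModel.DesignConditions (fun n => D n ω) s σν2 σε2 σa2 dbar) :
    TendstoInMeasure P
      (fun n ω => (D n ω).sigmaASqHat (u n) ((D n ω).response (ν n ω) (γ n ω) (ε n ω)))
      atTop (fun _ => σa2) ∧
    TendstoInMeasure P
      (fun n ω => (D n ω).sigmaBSqHat (u n) ((D n ω).response (ν n ω) (γ n ω) (ε n ω)))
      atTop (fun _ => σb2) ∧
    TendstoInMeasure P (fun n ω => (D n ω).dHat) atTop (fun _ => dbar) := by
  have hred : ∀ᵐ ω ∂P, ∀ n, (D n ω).IsReduction := hcond.mono fun ω h => h.reduction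
  -- The differences `u n - s n` are integers, so eventually exceeding `-1/2` means being
  -- nonnegative.
  have hus' : ∀ᶠ n in atTop, s n ≤ u n := by
    have h1 : ((-(1 / 2) : ℝ) : EReal)
        < liminf (fun n => (((u n : ℝ) - (s n : ℝ) : ℝ) : EReal)) atTop :=
      lt_of_lt_of_le (by exact_mod_cast (by norm_num : (-(1 / 2) : ℝ) < 0)) hus
    filter_upwards [eventually_lt_of_lt_liminf h1] with n hn
    have h2 : (-(1 / 2) : ℝ) < (u n : ℝ) - s n := EReal.coe_lt_coe_iff.1 hn
    by_contra hcon
    have h3 : (u n : ℝ) + 1 ≤ s n := by exact_mod_cast not_le.1 hcon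
    linarith
  have hζ : ∀ n, AEMeasurable (fun ω => (ν n ω, ε n ω)) P := fun n =>
    (hν n).aemeasurable.prodMk (hε n).aemeasurable
  have hY : ∀ n, Measurable fun x : MixedModel.Design n (p n) (v n) (r n) (na n) (nb n) ×
      (EuclideanSpace ℝ (Fin (v n)) × EuclideanSpace ℝ (Fin n)) =>
      x.1.response x.2.1 0 x.2.2 := fun n =>
    MixedModel.Design.measurable_response measurable_fst (measurable_fst.comp measurable_snd)
      (measurable_snd.comp measurable_snd)
  have hfixed := hcond.mono fun ω h => h.tendstoInMeasure_estimators hσν hσε hσa hdbar hν hε hνε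
    hna hnb hσb_lim hu_le hus' hulog
  refine ⟨?_, ?_, ?_⟩
  -- The result is proved with `γ` replaced by `0`, which changes the estimator only on a null set;
  -- so nothing about the law of `γ` or its dependence on the rest is needed.
  · refine (MixedModel.tendstoInMeasure_of_forall_ae_indep hD hζ hindep
      (T := fun n x => x.1.sigmaASqHat (u n) (x.1.response x.2.1 0 x.2.2))
      (fun n => MixedModel.Design.measurable_sigmaASqHat measurable_fst (hY n) (u n))
      (hfixed.mono fun ω h => h.1)).congr_left fun n => hred.mono fun ω h => ?_
    exact ((h n).sigmaASqHat_response _ _ _ _).symm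
  · refine (MixedModel.tendstoInMeasure_of_forall_ae_indep hD hζ hindep
      (T := fun n x => x.1.sigmaBSqHat (u n) (x.1.response x.2.1 0 x.2.2))
      (fun n => MixedModel.Design.measurable_sigmaBSqHat measurable_fst (hY n) (u n))
      (hfixed.mono fun ω h => h.2)).congr_left fun n => hred.mono fun ω h => ?_
    exact ((h n).sigmaBSqHat_response _ _ _ _).symm
  · exact tendstoInMeasure_of_tendsto_ae
      (fun n => (MixedModel.Design.measurable_dHat.comp (hD n)).aestronglyMeasurable)
      (hcond.mono fun ω h => h.tendsto_dbar)
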